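/- Let $K$ be a field, $n\ge 2$, $r:=n-2$, $R=K[x_0,\dots,x_r,t,u]$ the coordinate ring of $\mathbb P^n$, $I_L=(x_0,\dots,x_r)$ the ideal of a line $L\subset\mathbb P^n$, and $S=K[t,u]$ its coordinate ring. Let $0\le k\le r+1$ and let $C\subset\mathbb P^n$ be an $(n-k)$-rope supported on $L$, i.e. a one-dimensional locally Cohen-Macaulay closed subscheme of degree $n-k$ with support $L$ whose homogeneous ideal $I_C$ contains $I_L^2$. Let $A$ (of size $(r+1-k)\times(r+1)$, rows indexed by $0,\dots,r-k$) and $B$ (of size $(r+1)\times k$) be matrices over $S$ related to $C$, with integers $\alpha_0,\dots,\alpha_{r-k}$ and $\beta_1,\dots,\beta_k$. This means that the entries of the $i$-th row of $A$ are homogeneous of degree $\alpha_i$, those of the $j$-th column of $B$ are homogeneous of degree $\beta_j$, that $$0\to\bigoplus_{j=1}^k\mathcal O_L(-\beta_j-1)\xrightarrow{\;B\;}\mathcal O_L^{r+1}(-1)\xrightarrow{\;A\;}\bigoplus_{i=0}^{r-k}\mathcal O_L(\alpha_i-1)\to0$$ is an exact sequence of sheaves on $L\cong\mathbb P^1$,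 and that $I_C=(I_L^2,\,[x_0,\dots,x_r]B)$. Put $\alpha_{-1}:=1$, $P:=R(-1)^{r+1}$, and $H^0_*(C,\mathcal O_C):=\bigoplus_{d\in\mathbb Z}H^0(C,\mathcal O_C(d))$. Then there are $z_0,\dots,z_{r-k}\in H^0_*(C,\mathcal O_C)$, $z_i$ homogeneous of degree $1-\alpha_i$, with $[x_0,\dots,x_r]=[z_0,\dots,z_{r-k}]A$ in $H^0_*(C,\mathcal O_C)$, such that $$0\to\bigoplus_{i=-1}^{r-k}\wedge^{r+1}P(\alpha_i-1)\xrightarrow{\varepsilon_{n-1}}\cdots\xrightarrow{\varepsilon_2}\bigoplus_{i=-1}^{r-k}P(\alpha_i-1)\xrightarrow{\varepsilon_1}\bigoplus_{i=-1}^{r-k}R(\alpha_i-1)\xrightarrow{\varepsilon_0}H^0_*(C,\mathcal O_C)\to0$$ is a graded free resolution of the $R$-module $H^0_*(C,\mathcal O_C)$. Here $\varepsilon_0$ maps the canonical basis $f_{-1},f_0,\dots,f_{r-k}$ to $1,z_0,\dots,z_{r-k}$, and for $j\ge1$ $$\varepsilon_j=\begin{pmatrix}\delta_j&&&\\-\delta_j(A_{0,\bullet})&\delta_j&&\\\vdots&&\ddots&\\-\delta_j(A_{r-k,\bullet})&&&\delta_j\end{pmatrix},$$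 where the non-specified entries are zero, $\delta_j$ is the $j$-th map of the Koszul complex with respect to $x_0,\dots,x_r$, and $\delta_j(A_{i,\bullet})$ is the $j$-th map of the Koszul complex with respect to the entries of the $i$-th row of $A$. Moreover, this resolution is minimal (the image of every $\varepsilon_j$, $j\ge1$, lies in $(x_0,\dots,x_r,t,u)$ times the target) if and only if $\alpha_i\ge1$ for all $i=0,\dots,r-k$. -/

import Mathlib

open MvPolynomial
open scoped DirectSum

noncomputable section

attribute [local instance] MvPolynomial.gradedAlgebra

namespace Rope

/-! ### Rings and gradings -/

/-- The coordinate ring `S = K[t, u]` of the line `L`. -/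
abbrev LineRing (K : Type*) [Field K] : Type _ := MvPolynomial (Fin 2) K

/-- The coordinate ring `R = K[x₀, …, x_r, t, u]` of `ℙⁿ`, `n = r + 2`.
The variable `x_j` is `X (Sum.inl j)`; the variables `t, u` are `X (Sum.inr 0)`, `X (Sum.inr 1)`. -/
abbrev SpaceRing (K : Type*) [Field K] (r : ℕ) : Type _ := MvPolynomial (Fin (r + 1) ⊕ Fin 2) K

/-- The inclusion `S ⊆ R`. -/
def incl (K : Type*) [Field K] (r : ℕ) : LineRing K →ₐ[K] SpaceRing K r := rename Sum.inr

/-- The homogeneous polynomials of degree `d ∈ ℤ`; only `0` if `d < 0`. -/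
def homPart (σ K : Type*) [Field K] (d : ℤ) : Submodule K (MvPolynomial σ K) :=
  if 0 ≤ d then homogeneousSubmodule σ K d.toNat else ⊥

lemma homPart_natCast (σ K : Type*) [Field K] (e : ℕ) :
    homPart σ K (e : ℤ) = homogeneousSubmodule σ K e := by
  simp [homPart]

lemma mul_mem_homPart {σ K : Type*} [Field K] {e : ℕ} {d : ℤ} {a b : MvPolynomial σ K}
    (ha : a ∈ homogeneousSubmodule σ K e) (hb : b ∈ homPart σ K d) :
    a * b ∈ homPart σ K (e + d) := by
  unfold homPart at hb ⊢
  by_cases hd : 0 ≤ d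
  · rw [if_pos hd] at hb
    rw [if_pos (by omega), show ((e : ℤ) + d).toNat = e + d.toNat by omega]
    exact SetLike.mul_mem_graded ha hb
  · rw [if_neg hd, Submodule.mem_bot] at hb
    simp [hb]

/-! ### The graded module `H⁰_*(C, 𝒪_C)`

A closed subscheme `C` of `ℙⁿ` is given by its saturated homogeneous ideal `I = I_C ⊆ R`. -/

section Sections

variable {K : Type*} [Field K] {r : ℕ}

/-- The points of the closed subscheme of `ℙⁿ = Proj R` defined by `I`: the relevant homogeneous
primes containing `I`, with the topology induced from `Proj R`. -/
abbrev Points (I : Ideal (SpaceRing K r)) : Type _ :=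
  ProjectiveSpectrum.zeroLocus (homogeneousSubmodule (Fin (r + 1) ⊕ Fin 2) K)
    (I : Set (SpaceRing K r))

/-- The localization `(R / I)_p` at a point `p`. It contains the stalks of all `𝒪_C(d)`, as the sets
of the fractions `a / b` with `a`, `b` homogeneous, `b ∉ p` and `deg a - deg b = d`. -/
abbrev Stalk (I : Ideal (SpaceRing K r)) (p : Points I) : Type _ :=
  LocalizedModule p.1.asHomogeneousIdeal.toIdeal.primeCompl (SpaceRing K r ⧸ I)

/-- `s` is near `p` given by a fraction `a / b` with `a`, `b` homogeneous, `deg a - deg b = d`. -/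
def IsFractionNear (I : Ideal (SpaceRing K r)) (d : ℤ) (s : ∀ p : Points I, Stalk I p)
    (p : Points I) : Prop :=
  ∃ U : Set (Points I), IsOpen U ∧ p ∈ U ∧ ∃ (e : ℕ) (a b : SpaceRing K r),
    a ∈ homPart _ K (d + e) ∧ b ∈ homogeneousSubmodule _ K e ∧
    ∀ q ∈ U, ∃ hb : b ∈ q.1.asHomogeneousIdeal.toIdeal.primeCompl,
      s q = LocalizedModule.mk (Ideal.Quotient.mk I a) ⟨b, hb⟩

/-- `H⁰(C, 𝒪_C(d))`: the global sections over `C` of the sheaf associated with the graded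
module `(R / I)(d)`. -/
def twistSections (I : Ideal (SpaceRing K r)) (d : ℤ) :
    AddSubgroup (∀ p : Points I, Stalk I p) where
  carrier := {s | ∀ p, IsFractionNear I d s p}
  zero_mem' := fun p => ⟨Set.univ, isOpen_univ, trivial, 0, 0, 1, Submodule.zero_mem _,
    isHomogeneous_one _ _, fun q _ => ⟨Submonoid.one_mem _, by
      rw [map_zero, LocalizedModule.zero_mk]; rfl⟩⟩
  add_mem' := by
    intro s s' hs hs' p
    obtain ⟨U, hU, hp, e, a, b, ha, hb, h⟩ := hs p
    obtain ⟨U', hU', hp', e', a', b', ha', hb', h'⟩ := hs' p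
    refine ⟨U ∩ U', hU.inter hU', ⟨hp, hp'⟩, e + e', b' * a + b * a', b * b', ?_,
      SetLike.mul_mem_graded hb hb', ?_⟩
    · refine Submodule.add_mem _ ?_ ?_
      · have := mul_mem_homPart hb' ha
        rwa [show (e' : ℤ) + (d + e) = d + ((e + e' : ℕ) : ℤ) by push_cast; ring] at this
      · have := mul_mem_homPart hb ha'
        rwa [show (e : ℤ) + (d + e') = d + ((e + e' : ℕ) : ℤ) by push_cast; ring] at this
    · rintro q ⟨hq, hq'⟩
      obtain ⟨hbq, hsq⟩ := h q hq
      obtain ⟨hbq', hsq'⟩ := h' q hq'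
      refine ⟨Submonoid.mul_mem _ hbq hbq', ?_⟩
      rw [Pi.add_apply, hsq, hsq', LocalizedModule.mk_add_mk]
      rfl
  neg_mem' := by
    intro s hs p
    obtain ⟨U, hU, hp, e, a, b, ha, hb, h⟩ := hs p
    refine ⟨U, hU, hp, e, -a, b, Submodule.neg_mem _ ha, hb, fun q hq => ?_⟩
    obtain ⟨hbq, hsq⟩ := h q hq
    refine ⟨hbq, ?_⟩
    rw [Pi.neg_apply, hsq, map_neg, LocalizedModule.mk_neg]

/-- Degrees `e ∈ ℕ` act on degrees `d ∈ ℤ` by `e + d`. -/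
instance natIntAddAction : AddAction ℕ ℤ where
  vadd e d := (e : ℤ) + d
  zero_vadd d := by change ((0 : ℕ) : ℤ) + d = d; simp
  add_vadd e e' d := by
    change ((e + e' : ℕ) : ℤ) + d = (e : ℤ) + ((e' : ℤ) + d); push_cast; ring

instance gradedSMul (I : Ideal (SpaceRing K r)) :
    SetLike.GradedSMul (homogeneousSubmodule (Fin (r + 1) ⊕ Fin 2) K) (twistSections I) where
  smul_mem := by
    intro e d f s hf hs p
    obtain ⟨U, hU, hp, e', a, b, ha, hb, h⟩ := hs p
    refine ⟨U, hU, hp, e', f * a, b, ?_, hb, fun q hq => ?_⟩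
    · have := mul_mem_homPart hf ha
      rwa [← add_assoc] at this
    · obtain ⟨hbq, hsq⟩ := h q hq
      refine ⟨hbq, ?_⟩
      rw [Pi.smul_apply, hsq, LocalizedModule.smul'_mk]
      rfl

/-- `H⁰_*(C, 𝒪_C) = ⨁_{d ∈ ℤ} H⁰(C, 𝒪_C(d))`. -/
def GlobalSections (I : Ideal (SpaceRing K r)) : Type _ := ⨁ d : ℤ, twistSections I d

instance (I : Ideal (SpaceRing K r)) : AddCommGroup (GlobalSections I) :=
  inferInstanceAs (AddCommGroup (⨁ d : ℤ, twistSections I d))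

/-- The `R`-module structure: `f • s ∈ H⁰(C, 𝒪_C(e + d))` for `f ∈ R_e`, `s ∈ H⁰(C, 𝒪_C(d))`. -/
instance (I : Ideal (SpaceRing K r)) : Module (SpaceRing K r) (GlobalSections I) :=
  GradedModule.isModule (homogeneousSubmodule (Fin (r + 1) ⊕ Fin 2) K) (twistSections I)

/-- The homogeneous part of degree `d` of `H⁰_*(C, 𝒪_C)`. -/
def GlobalSections.part (I : Ideal (SpaceRing K r)) (d : ℤ) : AddSubgroup (GlobalSections I) :=
  (DirectSum.of (fun d : ℤ => twistSections I d) d).range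

/-- The constant section `1 ∈ H⁰(C, 𝒪_C)`. -/
def GlobalSections.one (I : Ideal (SpaceRing K r)) : GlobalSections I :=
  DirectSum.of (fun d : ℤ => twistSections I d) 0
    ⟨fun _ => LocalizedModule.mk 1 1, fun _ => ⟨Set.univ, isOpen_univ, trivial, 0, 1, 1,
      (homPart_natCast _ K 0).symm ▸ isHomogeneous_one (Fin (r + 1) ⊕ Fin 2) K,
      isHomogeneous_one _ _, fun _ _ => ⟨Submonoid.one_mem _, rfl⟩⟩⟩

end Sections

/-! ### Ropes on the line `L` and the matrices related to them -/

section Ropes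

variable {K : Type*} [Field K] {r : ℕ}

/-- The ideal `I_L = (x₀, …, x_r)` of the line `L`. -/
def lineIdeal (K : Type*) [Field K] (r : ℕ) : Ideal (SpaceRing K r) :=
  Ideal.span (Set.range fun j : Fin (r + 1) => X (Sum.inl j))

/-- The Hilbert function `d ↦ dim_K (R / I)_d`. -/
def hilbertFunction (I : Ideal (SpaceRing K r)) (d : ℕ) : ℕ :=
  Module.finrank K
    ((homogeneousSubmodule (Fin (r + 1) ⊕ Fin 2) K d).map (Ideal.Quotient.mkₐ K I).toLinearMap)

/-- `I` is the homogeneous ideal of a rope of degree `δ` supported on `L`, i.e. of a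
one-dimensional locally Cohen-Macaulay closed subscheme `C` of `ℙⁿ` with support `L`
whose ideal contains `I_L²`. A saturated homogeneous ideal defines a scheme with support `L`
and without embedded points (that is, locally Cohen-Macaulay, the dimension being one) exactly if
it is primary with radical `I_L`. The degree is the leading coefficient of the Hilbert
polynomial. -/
structure IsRope (I : Ideal (SpaceRing K r)) (δ : ℕ) : Prop where
  homogeneous : I.IsHomogeneous (homogeneousSubmodule (Fin (r + 1) ⊕ Fin 2) K)
  primary : I.IsPrimary
  radical_eq : I.radical = lineIdeal K r
  sq_le : lineIdeal K r ^ 2 ≤ I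
  degree : ∃ c : ℤ, ∀ᶠ d : ℕ in Filter.atTop, (hilbertFunction I d : ℤ) = δ * d + c

/-- The sequence of sheaves on `ℙ¹ = Proj S`
`0 → ⨁_l 𝒪(-β_l - 1) --B--> 𝒪(-1)^{r+1} --A--> ⨁_i 𝒪(α_i - 1) → 0`
defined by two matrices with homogeneous entries of the appropriate degrees is exact: it is so after
localization at every point of `Proj S`. -/
def SheafExact {m k : ℕ} (A : Matrix (Fin m) (Fin (r + 1)) (LineRing K))
    (B : Matrix (Fin (r + 1)) (Fin k) (LineRing K)) : Prop :=
  ∀ p : ProjectiveSpectrum (homogeneousSubmodule (Fin 2) K),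
    let loc := algebraMap (LineRing K) (Localization.AtPrime p.asHomogeneousIdeal.toIdeal)
    Function.Injective (B.map loc).mulVec ∧
    Function.Exact (B.map loc).mulVec (A.map loc).mulVec ∧
    Function.Surjective (A.map loc).mulVec

/-- `A` and `B` (with degrees `α`, `β`) are matrices related to the rope with ideal `I`:
`0 → ⨁_l 𝒪(-β_l - 1) --B--> 𝒪(-1)^{r+1} --A--> ⨁_i 𝒪(α_i - 1) → 0` is an exact
sequence of sheaves on `L`, and `I = (I_L², [x₀, …, x_r] B)`. -/
structure IsRelated (I : Ideal (SpaceRing K r)) {m k : ℕ} (α : Fin m → ℤ) (β : Fin k → ℤ)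
    (A : Matrix (Fin m) (Fin (r + 1)) (LineRing K))
    (B : Matrix (Fin (r + 1)) (Fin k) (LineRing K)) : Prop where
  homogeneous_left : ∀ i j, A i j ∈ homPart (Fin 2) K (α i)
  homogeneous_right : ∀ j l, B j l ∈ homPart (Fin 2) K (β l)
  exact : SheafExact A B
  ideal_eq : I = lineIdeal K r ^ 2 ⊔
    Ideal.span (Set.range fun l : Fin k => ∑ j, X (Sum.inl j) * incl K r (B j l))

end Ropes

/-! ### Koszul maps -/

section Koszul

/-- The Koszul map `⋀^{j+1} Rᴺ → ⋀^j Rᴺ` with respect to the elements `v₀, …, v_{N-1}`: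
`u₀ ∧ … ∧ u_j ↦ ∑_i (-1)^i v(u_i) u₀ ∧ … ∧ û_i ∧ … ∧ u_j`, where `v` is the linear form with
`v(e_l) = v_l`. -/
def koszulMap {R : Type*} [CommRing R] {N : ℕ} (v : Fin N → R) (j : ℕ) :
    ⋀[R]^(j + 1) (Fin N → R) →ₗ[R] ⋀[R]^j (Fin N → R) :=
  exteriorPower.alternatingMapLinearEquiv
    (AlternatingMap.alternatizeUncurryFin
      ((Fintype.linearCombination R v).smulRight (exteriorPower.ιMulti R j)))

variable (K : Type*) [Field K] (r : ℕ)

/-- `⋀^j P` with `P = R(-1)^{r+1}`; the grading is given by `koszulPart`. -/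
abbrev KoszulTerm (j : ℕ) : Type _ := ⋀[SpaceRing K r]^j (Fin (r + 1) → SpaceRing K r)

/-- The homogeneous part of degree `d` of `(⋀^j P)(c)`. The basis elements of `⋀^j P` have
degree `j`, so that it consists of the elements with coordinates in `R_{d + c - j}`. -/
def koszulPart (j : ℕ) (c d : ℤ) : AddSubgroup (KoszulTerm K r j) where
  carrier := {ω | ∀ s,
    ((Pi.basisFun (SpaceRing K r) (Fin (r + 1))).exteriorPower (R := SpaceRing K r) j).repr ω s ∈
      homPart _ K (d + c - j)}
  zero_mem' := fun s => by simp
  add_mem' := fun h h' s => by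
    rw [map_add, Finsupp.add_apply]; exact Submodule.add_mem _ (h s) (h' s)
  neg_mem' := fun h s => by
    rw [map_neg, Finsupp.neg_apply]; exact Submodule.neg_mem _ (h s)

end Koszul

/-! ### Graded free resolutions over `R` -/

section Resolutions

variable {K : Type*} [Field K] {r : ℕ}

/-- `F` with homogeneous parts `𝓕 d` is a finitely generated graded free `R`-module `⨁_i R(-δ_i)`:
it has a finite basis consisting of homogeneous elements `b_i` of degrees `δ_i`. -/
def IsGradedFree (K : Type*) [Field K] (r : ℕ) {F : Type*} [AddCommGroup F] [Module (SpaceRing K r) F]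
    (𝓕 : ℤ → AddSubgroup F) : Prop :=
  ∃ (N : ℕ) (b : Module.Basis (Fin N) (SpaceRing K r) F) (δ : Fin N → ℤ),
    ∀ d x, x ∈ 𝓕 d ↔ ∀ i, b.repr x i ∈ homPart _ K (d - δ i)

/-- `⋯ → F₂ → F₁ → F₀ → M → 0` is a graded free resolution of the graded module `M`: the `F_j` are
finitely generated graded free modules, the maps are homogeneous of degree zero, and the
sequence is exact. -/
structure IsGradedFreeResolution {F : ℕ → Type*} [∀ j, AddCommGroup (F j)]
    [∀ j, Module (SpaceRing K r) (F j)] (𝓕 : ∀ j, ℤ → AddSubgroup (F j))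
    (ε : ∀ j, F (j + 1) →ₗ[SpaceRing K r] F j)
    {M : Type*} [AddCommGroup M] [Module (SpaceRing K r) M] (𝓜 : ℤ → AddSubgroup M)
    (ε₀ : F 0 →ₗ[SpaceRing K r] M) : Prop where
  free : ∀ j, IsGradedFree K r (𝓕 j)
  degree_zero : ∀ j d x, x ∈ 𝓕 (j + 1) d → ε j x ∈ 𝓕 j d
  augmentation_degree_zero : ∀ d x, x ∈ 𝓕 0 d → ε₀ x ∈ 𝓜 d
  exact : ∀ j, Function.Exact (ε (j + 1)) (ε j)
  augmentation_exact : Function.Exact (ε 0) ε₀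
  augmentation_surjective : Function.Surjective ε₀

/-- A graded free resolution is minimal if the image of each `F_{j+1} → F_j` lies in `𝔪 F_j`, where
`𝔪 ⊆ R` is the ideal generated by all variables. -/
def IsMinimal {F : ℕ → Type*} [∀ j, AddCommGroup (F j)] [∀ j, Module (SpaceRing K r) (F j)]
    (ε : ∀ j, F (j + 1) →ₗ[SpaceRing K r] F j) : Prop :=
  ∀ j, LinearMap.range (ε j) ≤
    Ideal.span (Set.range (X : Fin (r + 1) ⊕ Fin 2 → SpaceRing K r)) •
      (⊤ : Submodule (SpaceRing K r) (F j))

end Resolutions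

/-! ### The complex attached to the matrix `A` -/

section Complex

variable {K : Type*} [Field K] {r m : ℕ}

/-- The `j`-th term `⨁_{i=-1}^{m-1} ⋀^j P(α_i - 1)`; the index `-1` is `none`. -/
abbrev Term (K : Type*) [Field K] (r m j : ℕ) : Type _ := Option (Fin m) → KoszulTerm K r j

/-- The degrees `α_{-1} = 1, α₀, …, α_{m-1}`. -/
def extDegree (α : Fin m → ℤ) : Option (Fin m) → ℤ
  | none => 1
  | some i => α i

/-- The homogeneous part of degree `d` of `⨁_{i=-1}^{m-1} ⋀^j P(α_i - 1)`. -/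
def termPart (K : Type*) [Field K] (r : ℕ) (α : Fin m → ℤ) (j : ℕ) (d : ℤ) :
    AddSubgroup (Term K r m j) :=
  AddSubgroup.pi Set.univ fun i => koszulPart K r j (extDegree α i - 1) d

/-- The map `ε_{j+1}` from the term with index `j + 1` to the term with index `j`, given by the block
matrix with `δ_{j+1}` on the diagonal, `-δ_{j+1}(A_{i,•})` in row `i ≥ 0` of column `-1`,
and zeros elsewhere. -/
def epsilon (A : Matrix (Fin m) (Fin (r + 1)) (LineRing K)) (j : ℕ) :
    Term K r m (j + 1) →ₗ[SpaceRing K r] Term K r m j :=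
  LinearMap.pi fun
    | none => koszulMap (fun l => X (Sum.inl l)) j ∘ₗ LinearMap.proj none
    | some i =>
      -(koszulMap (fun l => incl K r (A i l)) j ∘ₗ LinearMap.proj none) +
        koszulMap (fun l => X (Sum.inl l)) j ∘ₗ LinearMap.proj (some i)

/-- The map `ε₀ : ⨁_{i=-1}^{m-1} R(α_i - 1) → H⁰_*(C, 𝒪_C)` with
`f_{-1} ↦ 1`, `f_i ↦ z_i` for `i ≥ 0`, where `⋀⁰ P = R`. -/
def augmentation (I : Ideal (SpaceRing K r)) (z : Fin m → GlobalSections I) :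
    Term K r m 0 →ₗ[SpaceRing K r] GlobalSections I :=
  (exteriorPower.zeroEquiv (SpaceRing K r) (Fin (r + 1) → SpaceRing K r)).toLinearMap.smulRight
      (GlobalSections.one I) ∘ₗ LinearMap.proj none +
    ∑ i : Fin m,
      (exteriorPower.zeroEquiv (SpaceRing K r) (Fin (r + 1) → SpaceRing K r)).toLinearMap.smulRight
        (z i) ∘ₗ LinearMap.proj (some i)

end Complex

end Rope

end

/-! Every point of `C` contains `I_L`, so `C` has a single generic point, and everything is computed
there. Sending `x_l` to `∑_i A_{il} z_i`, with all products `z_i z_{i'}` equal to zero, maps `R` to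
`Frac S ⊕ ⨁_i (Frac S) z_i` (`GenericStalk`). The ideal `I` goes to zero because `A B = 0`.

A section is determined by its value in this ring: by exactness in the middle, an element of `R`
with image zero is killed, near each point, by something that does not vanish there
(`exists_mul_mem`). The coefficients of that value lie in `S`, because their denominators can be
chosen prime to any given irreducible and `S` is factorial (`stalkEval_mem_part`). Conversely each
`z_i` is a section, because `A` is locally surjective (`exists_section`). Hence `H⁰_*(C, 𝒪_C) = S ⊕
⨁_i S z_i` with `x_l · 1 = ∑_i A_{il} z_i` and `x_l z_i = 0`, an extension of `S` by `⨁_i S(α_i -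
1)`.

The Koszul complex of `x₀, …, x_r` resolves `S = R/(x)` (`koszulMap_exact`). The horseshoe
construction combines these resolutions, with off-diagonal maps `-δ(A_i)`; it is a complex because
contractions with two linear forms anticommute (`koszulMap_comm`). Its exactness is a short diagram
chase (`epsilon_exact`, `augmentation_exact`). Minimality depends only on whether some entry of `A`
is a nonzero constant. -/

noncomputable section

attribute [local instance] MvPolynomial.gradedAlgebra

namespace Rope

/-! ### Exactness of the Koszul complex -/

section KoszulExact

open CliffordAlgebra (contractLeft)

variable {R : Type*} [CommRing R] {N : ℕ}

/-- The differential of the Koszul complex on the exterior algebra: contraction with the linear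
form with coefficients `v`. -/
abbrev contractForm (v : Fin N → R) :
    ExteriorAlgebra R (Fin N → R) →ₗ[R] ExteriorAlgebra R (Fin N → R) :=
  contractLeft (Q := (0 : QuadraticForm R (Fin N → R))) (Fintype.linearCombination R v)

lemma contractForm_ι_mul (v m : Fin N → R) (x : ExteriorAlgebra R (Fin N → R)) :
    contractForm v (ExteriorAlgebra.ι R m * x) =
      (∑ i, m i * v i) • x - ExteriorAlgebra.ι R m * contractForm v x := by
  have := CliffordAlgebra.contractLeft_ι_mul (Q := (0 : QuadraticForm R (Fin N → R)))
    (d := Fintype.linearCombination R v) m x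
  rw [Fintype.linearCombination_apply] at this
  exact this

lemma contractForm_algebraMap (v : Fin N → R) (c : R) :
    contractForm v (algebraMap R (ExteriorAlgebra R (Fin N → R)) c) = 0 :=
  CliffordAlgebra.contractLeft_algebraMap _ _ _

lemma contractForm_contractForm (v : Fin N → R) (x : ExteriorAlgebra R (Fin N → R)) :
    contractForm v (contractForm v x) = 0 :=
  CliffordAlgebra.contractLeft_contractLeft _ _

lemma contractForm_comm (v w : Fin N → R) (x : ExteriorAlgebra R (Fin N → R)) :
    contractForm v (contractForm w x) = -contractForm w (contractForm v x) :=
  CliffordAlgebra.contractLeft_comm _ _ _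

lemma contractForm_eq_sum (v : Fin N → R) (x : ExteriorAlgebra R (Fin N → R)) :
    contractForm v x = ∑ i, v i • contractForm (Pi.single i 1) x := by
  have h : Fintype.linearCombination R v =
      ∑ i, v i • Fintype.linearCombination R (Pi.single i (1 : R)) := by
    ext j
    simp [Fintype.linearCombination_apply, Pi.single_apply]
  unfold contractForm
  rw [h, map_sum, LinearMap.sum_apply]
  simp only [map_smul, LinearMap.smul_apply]

/-- This moves all Koszul computations into the exterior algebra, where the identities of
contraction are available. The alternating sum arises by splitting off the first factor repeatedly.
-/
lemma coe_koszulMap (v : Fin N → R) (j : ℕ) (ω : ⋀[R]^(j + 1) (Fin N → R)) :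
    (koszulMap v j ω : ExteriorAlgebra R (Fin N → R)) = contractForm v ω := by
  have key : ∀ (j : ℕ) (u : Fin (j + 1) → Fin N → R),
      contractForm v (ExteriorAlgebra.ιMulti R (j + 1) u) =
        ∑ i : Fin (j + 1), (-1 : ℤ) ^ (i : ℕ) • (∑ l, u i l * v l) •
          ExteriorAlgebra.ιMulti R j (i.removeNth u) := by
    intro j
    induction j with
    | zero =>
      intro u
      rw [ExteriorAlgebra.ιMulti_succ_apply, contractForm_ι_mul]
      simp [ExteriorAlgebra.ιMulti_zero_apply, CliffordAlgebra.contractLeft_one]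
    | succ j ih =>
      intro u
      rw [ExteriorAlgebra.ιMulti_succ_apply, contractForm_ι_mul, ih,
        sub_eq_add_neg]
      conv_rhs => rw [Fin.sum_univ_succ]
      congr 1
      · simp [Fin.removeNth_zero, Matrix.vecTail, Fin.tail_def, Function.comp_def]
      · rw [Finset.mul_sum, ← Finset.sum_neg_distrib]
        refine Finset.sum_congr rfl fun i _ => ?_
        rw [ExteriorAlgebra.ιMulti_succ_apply]
        have h1 : Fin.removeNth i.succ u 0 = u 0 := by
          simp [Fin.removeNth]
        have h2 : Matrix.vecTail (Fin.removeNth i.succ u) = i.removeNth (Matrix.vecTail u) := by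
          ext l
          simp [Fin.removeNth, Matrix.vecTail]
        rw [h1, h2, Fin.val_succ, pow_succ]
        simp only [Matrix.vecTail, Function.comp_apply, mul_neg, mul_one, neg_smul, mul_smul_comm]
  have : (Submodule.subtype _) ∘ₗ koszulMap v j =
      contractForm v ∘ₗ Submodule.subtype (⋀[R]^(j + 1) (Fin N → R)) := by
    apply exteriorPower.linearMap_ext
    ext u
    simp only [LinearMap.compAlternatingMap_apply, LinearMap.comp_apply, koszulMap,
      exteriorPower.alternatingMapLinearEquiv_apply_ιMulti, Submodule.subtype_apply,
      AlternatingMap.alternatizeUncurryFin_apply, exteriorPower.ιMulti_apply_coe, key]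
    simp [Fintype.linearCombination_apply]
  exact LinearMap.congr_fun this ω

lemma koszulMap_koszulMap (v : Fin N → R) (j : ℕ) (ω : ⋀[R]^(j + 1 + 1) (Fin N → R)) :
    koszulMap v j (koszulMap v (j + 1) ω) = 0 := by
  ext
  simp [coe_koszulMap, contractForm_contractForm]

lemma koszulMap_comm (v w : Fin N → R) (j : ℕ) (ω : ⋀[R]^(j + 1 + 1) (Fin N → R)) :
    koszulMap v j (koszulMap w (j + 1) ω) = -koszulMap w j (koszulMap v (j + 1) ω) := by
  ext
  rw [Submodule.coe_neg]
  simp only [coe_koszulMap]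
  exact contractForm_comm v w _

/-- The product subtracted is the part of `x` that involves the basis vector `e_i`; what remains is
`x` with `e_i` set to zero. -/
lemma sub_ι_mul_contractForm_single (i : Fin N) (x : ExteriorAlgebra R (Fin N → R)) :
    x - ExteriorAlgebra.ι R (Pi.single i 1) * contractForm (Pi.single i 1) x =
      ExteriorAlgebra.map (LinearMap.id - LinearMap.single R (fun _ => R) i ∘ₗ LinearMap.proj i)
        x := by
  induction x using CliffordAlgebra.left_induction with
  | algebraMap c =>
    rw [contractForm_algebraMap]
    simp
  | add x y hx hy => rw [map_add, map_add, ← hx, ← hy]; noncomm_ring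
  | ι_mul x m hx =>
    change ExteriorAlgebra.ι R m * x - _ * contractForm _ (ExteriorAlgebra.ι R m * x) =
      ExteriorAlgebra.map _ (ExteriorAlgebra.ι R m * x)
    rw [map_mul (ExteriorAlgebra.map _), ← hx, contractForm_ι_mul, ExteriorAlgebra.map_apply_ι]
    have h1 : (LinearMap.id - LinearMap.single R (fun _ : Fin N => R) i ∘ₗ LinearMap.proj i :
        (Fin N → R) →ₗ[R] (Fin N → R)) m =
        m - m i • Pi.single i 1 := by
      ext l
      simp [Pi.single_apply]
    have h2 : ∑ l, m l * (Pi.single i 1 : Fin N → R) l = m i := by simp [Pi.single_apply]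
    rw [h1, h2, map_sub, map_smul]
    set e := ExteriorAlgebra.ι R (Pi.single i 1 : Fin N → R)
    set n := ExteriorAlgebra.ι R m
    set y := contractForm (Pi.single i 1) x
    have h3 : e * n = -(n * e) := by
      rw [eq_neg_iff_add_eq_zero]
      exact ExteriorAlgebra.ι_add_mul_swap _ _
    have h4 : e * e = 0 := ExteriorAlgebra.ι_sq_zero _
    rw [mul_sub, sub_mul, mul_sub, mul_sub, ← mul_assoc e n, h3, smul_mul_assoc, smul_mul_assoc,
      ← mul_assoc e e, h4, mul_smul_comm, zero_mul, smul_zero, sub_zero]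
    noncomm_ring

/-- Such an `x` is unchanged when the basis vectors are set to zero one after another, hence fixed
by the map induced by `0`, which is the projection onto scalars. -/
lemma eq_algebraMap_of_contractForm_eq_zero (x : ExteriorAlgebra R (Fin N → R))
    (h : ∀ i, contractForm (Pi.single i 1) x = 0) : ∃ c, x = algebraMap R _ c := by
  have key : ∀ t : Finset (Fin N), ∃ f : (Fin N → R) →ₗ[R] (Fin N → R),
      (∀ i ∈ t, f (Pi.single i 1) = 0) ∧ ExteriorAlgebra.map f x = x := by
    intro t
    induction t using Finset.induction_on with
    | empty => exact ⟨LinearMap.id, by simp, by simp⟩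
    | insert i t hi ih =>
      obtain ⟨f, hf, hx⟩ := ih
      refine ⟨f ∘ₗ (LinearMap.id - LinearMap.single R (fun _ => R) i ∘ₗ LinearMap.proj i), ?_, ?_⟩
      · intro l hl
        rcases Finset.mem_insert.mp hl with rfl | hl
        · simp
        · have hne : l ≠ i := fun h => hi (h ▸ hl)
          simp [hf l hl, hne]
      · rw [← ExteriorAlgebra.map_comp_map, AlgHom.comp_apply, ← sub_ι_mul_contractForm_single, h i,
          mul_zero, sub_zero, hx]
  obtain ⟨f, hf, hx⟩ := key Finset.univ
  have hf0 : f = 0 := by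
    ext i l
    simp [hf i (Finset.mem_univ i)]
  subst hf0
  refine ⟨ExteriorAlgebra.algebraMapInv x, ?_⟩
  rw [← hx]
  have : ExteriorAlgebra.map (0 : (Fin N → R) →ₗ[R] (Fin N → R)) =
      (Algebra.ofId R (ExteriorAlgebra R (Fin N → R))).comp
        (ExteriorAlgebra.algebraMapInv.comp
          (ExteriorAlgebra.map (0 : (Fin N → R) →ₗ[R] (Fin N → R)))) := by
    ext : 1
    ext m
    simp [ExteriorAlgebra.algebraMapInv]
  exact DFunLike.congr_fun this x

/-- The elements `v₀, …, v_{N-1}` form a weakly regular sequence. -/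
def IsWeaklyRegularFamily (v : Fin N → R) : Prop :=
  ∀ (p : Fin N) (c : R) (y : Fin N → R), (∀ j, p ≤ j → y j = 0) → v p * c = ∑ j, y j * v j →
    ∃ y' : Fin N → R, (∀ j, p ≤ j → y' j = 0) ∧ c = ∑ j, y' j * v j

/-- The vanishing contractions say that only `e_0, …, e_{p-1}` occur, and the induction adds one
basis vector at a time. The scalar `c` cannot be avoided, since scalars are cycles but need not be
boundaries. -/
lemma exists_contractForm_add_algebraMap {v : Fin N → R} (hv : IsWeaklyRegularFamily v) (p : ℕ)
    (hp : p ≤ N) (ω : ExteriorAlgebra R (Fin N → R))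
    (hω : ∀ i : Fin N, p ≤ i → contractForm (Pi.single i 1) ω = 0) (hd : contractForm v ω = 0) :
    ∃ η, (∀ i : Fin N, p ≤ i → contractForm (Pi.single i 1) η = 0) ∧
      ∃ c, ω = contractForm v η + algebraMap R _ c := by
  induction p generalizing ω with
  | zero =>
    obtain ⟨c, hc⟩ := eq_algebraMap_of_contractForm_eq_zero ω fun i => hω i (Nat.zero_le _)
    exact ⟨0, by simp, c, by simpa using hc⟩
  | succ p ih =>
    set q : Fin N := ⟨p, hp⟩ with hq
    have sum_single : ∀ (i : Fin N) (m : Fin N → R),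
        ∑ l, m l * (Pi.single i 1 : Fin N → R) l = m i := by
      intro i m
      simp [Pi.single_apply]
    have hcase : ∀ i : Fin N, p ≤ i → i = q ∨ p + 1 ≤ (i : ℕ) := by
      intro i hi
      rcases Nat.eq_or_lt_of_le hi with h | h
      · exact Or.inl (Fin.ext h.symm)
      · exact Or.inr h
    set e := ExteriorAlgebra.ι R (Pi.single q 1 : Fin N → R) with he
    set b := contractForm (Pi.single q 1) ω with hb
    have hbE : ∀ i : Fin N, p ≤ i → contractForm (Pi.single i 1) b = 0 := by
      intro i hi
      rcases hcase i hi with rfl | h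
      · exact contractForm_contractForm _ _
      · rw [hb, contractForm_comm, hω i h, map_zero, neg_zero]
    have hemul : ∀ (x : ExteriorAlgebra R (Fin N → R)) (i : Fin N), p ≤ i →
        contractForm (Pi.single i 1) x = 0 →
        contractForm (Pi.single i 1) (e * x) = if i = q then x else 0 := by
      intro x i _ hx
      rw [he, contractForm_ι_mul, hx, sum_single, mul_zero, sub_zero]
      by_cases h : i = q
      · simp [h]
      · simp [h]
    set a := ω - e * b with ha
    have haE : ∀ i : Fin N, p ≤ i → contractForm (Pi.single i 1) a = 0 := by
      intro i hi
      rw [ha, map_sub, hemul b i hi (hbE i hi)]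
      rcases hcase i hi with rfl | h
      · rw [if_pos rfl, sub_self]
      · rw [hω i h, if_neg (by rintro rfl; simp [hq] at h), sub_zero]
    have hdb : contractForm v b = 0 := by
      rw [hb, contractForm_comm, hd, map_zero, neg_zero]
    have hdemul : ∀ x, contractForm v (e * x) = v q • x - e * contractForm v x := by
      intro x
      rw [he, contractForm_ι_mul]
      simp [Pi.single_apply]
    have hda : contractForm v a = -(v q • b) := by
      rw [ha, map_sub, hd, hdemul, hdb]
      simp
    obtain ⟨β, hβE, c, hc⟩ := ih (by omega) b hbE hdb
    have hζ : contractForm v (-a - v q • β) = algebraMap R _ (v q * c) := by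
      rw [map_sub, map_neg, hda, map_smul, hc, map_mul, ← Algebra.smul_def, smul_add]
      abel
    -- Since `v_q c` is the differential of `-a - v_q β`, it is a combination of the `v_j` with `j <
    -- q`. Its coefficients are those of the linear part, found by contracting with the coordinate
    -- forms and projecting to scalars.
    obtain ⟨y, hy, hcy⟩ := hv q c
      (fun i => ExteriorAlgebra.algebraMapInv (contractForm (Pi.single i 1) (-a - v q • β)))
      (by
        intro j hj
        rw [map_sub, map_neg, map_smul, haE j hj, hβE j hj]
        simp)
      (by
        have := congrArg (ExteriorAlgebra.algebraMapInv (R := R) (M := Fin N → R)) hζ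
        rw [ExteriorAlgebra.algebraMap_leftInverse, contractForm_eq_sum, map_sum] at this
        rw [← this]
        refine Finset.sum_congr rfl fun i _ => ?_
        rw [map_smul, smul_eq_mul, mul_comm])
    -- The linear term `y` has differential `c`, so that the differential of `β'` is exactly `b`.
    set β' := β + ExteriorAlgebra.ι R y with hβ'
    have hι : ∀ w : Fin N → R, contractForm w (ExteriorAlgebra.ι R y) =
        algebraMap R _ (∑ l, y l * w l) := by
      intro w
      rw [← mul_one (ExteriorAlgebra.ι R y), contractForm_ι_mul,
        ← map_one (algebraMap R (ExteriorAlgebra R (Fin N → R))), contractForm_algebraMap, mul_zero,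
        sub_zero, Algebra.smul_def, map_one, mul_one]
    have hβ'E : ∀ i : Fin N, p ≤ i → contractForm (Pi.single i 1) β' = 0 := by
      intro i hi
      rw [hβ', map_add, hβE i hi, hι, sum_single, hy i hi, map_zero, add_zero]
    have hβ'd : contractForm v β' = b := by
      rw [hβ', map_add, hι, ← hcy, hc]
    -- This cycle does not involve `e_q`, and it differs from `ω = a + e b` by the differential of
    -- `e β'`.
    obtain ⟨η, hη, c', hc'⟩ := ih (by omega) (a + v q • β')
      (fun i hi => by rw [map_add, map_smul, haE i hi, hβ'E i hi]; simp)
      (by rw [map_add, map_smul, hβ'd, hda]; simp)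
    refine ⟨η - e * β', ?_, c', ?_⟩
    · intro i hi
      rw [map_sub, hη i (by omega), hemul β' i (by omega) (hβ'E i (by omega)),
        if_neg (by rintro rfl; simp [hq] at hi), sub_zero]
    · rw [map_sub, hdemul, hβ'd, sub_add_eq_add_sub, ← hc', ha]
      abel

lemma decompose_contractForm (v : Fin N → R) (j : ℕ) (η : ExteriorAlgebra R (Fin N → R)) :
    (DirectSum.decompose (fun i : ℕ => ⋀[R]^i (Fin N → R)) (contractForm v η) j :
      ExteriorAlgebra R (Fin N → R)) =
    contractForm v (DirectSum.decompose (fun i : ℕ => ⋀[R]^i (Fin N → R)) η (j + 1)) := by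
  induction η using DirectSum.Decomposition.inductionOn (fun i : ℕ => ⋀[R]^i (Fin N → R)) with
  | zero => simp
  | @homogeneous i m =>
    rcases i with _ | i
    · obtain ⟨m, hm⟩ := m
      obtain ⟨c, rfl⟩ : ∃ c, algebraMap R _ c = m := by
        simpa [Submodule.mem_one] using hm
      rw [contractForm_algebraMap, DirectSum.decompose_of_mem_ne (fun i : ℕ => ⋀[R]^i (Fin N → R)) hm (by omega)]
      simp
    · rw [← coe_koszulMap]
      by_cases h : i = j
      · subst h
        rw [DirectSum.decompose_of_mem_same (fun i : ℕ => ⋀[R]^i (Fin N → R)) (koszulMap v i m).2,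
          DirectSum.decompose_of_mem_same (fun i : ℕ => ⋀[R]^i (Fin N → R)) m.2, coe_koszulMap]
      · rw [DirectSum.decompose_of_mem_ne (fun i : ℕ => ⋀[R]^i (Fin N → R)) (koszulMap v i m).2 h,
          DirectSum.decompose_of_mem_ne (fun i : ℕ => ⋀[R]^i (Fin N → R)) m.2 (by omega), map_zero]
  | add x y hx hy =>
    simp only [map_add, DirectSum.decompose_add, DirectSum.add_apply, Submodule.coe_add, hx, hy]

/-- The Koszul complex of a weakly regular sequence is exact in positive degrees. -/
lemma koszulMap_exact {v : Fin N → R} (hv : IsWeaklyRegularFamily v) (j : ℕ) :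
    Function.Exact (koszulMap v (j + 1)) (koszulMap v j) := by
  intro ω
  constructor
  · intro h
    have hd : contractForm v (ω : ExteriorAlgebra R (Fin N → R)) = 0 := by
      rw [← coe_koszulMap, h]; rfl
    obtain ⟨η, -, c, hc⟩ := exists_contractForm_add_algebraMap hv N le_rfl ω
      (fun i hi => absurd i.2 (by omega)) hd
    -- The differential lowers degrees by one, so this component suffices. The scalar `c` has degree
    -- `0 ≠ j + 1` and drops out.
    refine ⟨DirectSum.decompose (fun i : ℕ => ⋀[R]^i (Fin N → R)) η (j + 1 + 1), ?_⟩
    ext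
    rw [coe_koszulMap, ← decompose_contractForm, eq_sub_of_add_eq hc.symm,
      DirectSum.decompose_sub, DirectSum.sub_apply, Submodule.coe_sub,
      DirectSum.decompose_of_mem_same (fun i : ℕ => ⋀[R]^i (Fin N → R)) ω.2,
      DirectSum.decompose_of_mem_ne (i := 0) (j := j + 1) (fun i : ℕ => ⋀[R]^i (Fin N → R))
        (by simp [Submodule.mem_one]) (by omega), sub_zero]
  · rintro ⟨η, rfl⟩
    exact koszulMap_koszulMap v j η

lemma zeroEquiv_koszulMap (v : Fin N → R) (y : Fin N → R) :
    exteriorPower.zeroEquiv R (Fin N → R)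
      (koszulMap v 0 ((exteriorPower.oneEquiv R (Fin N → R)).symm y)) = ∑ l, v l * y l := by
  have : (exteriorPower.oneEquiv R (Fin N → R)).symm y =
      exteriorPower.ιMulti R 1 (fun _ => y) := by
    rw [LinearEquiv.symm_apply_eq, exteriorPower.oneEquiv_ιMulti]
  rw [this, koszulMap, exteriorPower.alternatingMapLinearEquiv_apply_ιMulti,
    AlternatingMap.alternatizeUncurryFin_apply]
  simp [Fintype.linearCombination_apply, mul_comm]

end KoszulExact

/-! ### Homogeneous polynomials and the variables -/

section HomPart

variable {σ K : Type*} [Field K]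

lemma mem_homPart_of_nonneg {d : ℤ} (hd : 0 ≤ d) {a : MvPolynomial σ K} :
    a ∈ homPart σ K d ↔ a.IsHomogeneous d.toNat := by
  rw [homPart, if_pos hd, mem_homogeneousSubmodule]

lemma eq_zero_of_mem_homPart_of_neg {d : ℤ} (hd : d < 0) {a : MvPolynomial σ K}
    (ha : a ∈ homPart σ K d) : a = 0 := by
  rwa [homPart, if_neg (by omega), Submodule.mem_bot] at ha

lemma mul_mem_homPart_add {d e : ℤ} {a b : MvPolynomial σ K} (ha : a ∈ homPart σ K d)
    (hb : b ∈ homPart σ K e) : a * b ∈ homPart σ K (d + e) := by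
  by_cases hd : 0 ≤ d
  · lift d to ℕ using hd
    rw [homPart_natCast] at ha
    exact mul_mem_homPart ha hb
  · rw [eq_zero_of_mem_homPart_of_neg (by omega) ha, zero_mul]
    exact Submodule.zero_mem _

lemma X_mem_homPart (i : σ) : (X i : MvPolynomial σ K) ∈ homPart σ K 1 := by
  rw [mem_homPart_of_nonneg zero_le_one]
  exact isHomogeneous_X _ _

lemma rename_mem_homPart {τ : Type*} (f : σ → τ) {d : ℤ} {a : MvPolynomial σ K}
    (ha : a ∈ homPart σ K d) : rename f a ∈ homPart τ K d := by
  by_cases hd : 0 ≤ d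
  · rw [mem_homPart_of_nonneg hd] at ha ⊢
    exact ha.rename_isHomogeneous
  · rw [eq_zero_of_mem_homPart_of_neg (by omega) ha, map_zero]
    exact Submodule.zero_mem _

lemma incl_mem_homPart {r : ℕ} {d : ℤ} {a : LineRing K} (ha : a ∈ homPart _ K d) :
    incl K r a ∈ homPart _ K d :=
  rename_mem_homPart _ ha

lemma incl_injective (K : Type*) [Field K] (r : ℕ) : Function.Injective (incl K r) :=
  rename_injective _ Sum.inr_injective

lemma mem_span_range_X_iff {p : MvPolynomial σ K} :
    p ∈ Ideal.span (Set.range (X : σ → MvPolynomial σ K)) ↔ constantCoeff p = 0 := by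
  rw [← Set.image_univ, mem_ideal_span_X_image]
  constructor
  · intro h
    by_contra h0
    obtain ⟨i, -, hi⟩ := h 0 (mem_support_iff.mpr h0)
    exact hi rfl
  · intro h m hm
    by_contra! hc
    have : m = 0 := by
      ext i
      exact hc i trivial
    subst this
    exact mem_support_iff.mp hm h

lemma constantCoeff_eq_zero_of_mem_homPart {d : ℤ} (hd : d ≠ 0) {a : MvPolynomial σ K}
    (ha : a ∈ homPart σ K d) : constantCoeff a = 0 := by
  by_cases h : 0 ≤ d
  · rw [mem_homPart_of_nonneg h] at ha
    refine ha.coeff_eq_zero ?_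
    simp only [map_zero]
    omega
  · rw [eq_zero_of_mem_homPart_of_neg (by omega) ha, map_zero]

lemma eq_zero_of_mem_homPart_of_constantCoeff {d : ℤ} (hd : d ≤ 0) {a : MvPolynomial σ K}
    (ha : a ∈ homPart σ K d) (h : constantCoeff a = 0) : a = 0 := by
  rcases hd.lt_or_eq with hd | rfl
  · exact eq_zero_of_mem_homPart_of_neg hd ha
  · rw [mem_homPart_of_nonneg le_rfl, Int.toNat_zero] at ha
    have hc : a = C (coeff 0 a) :=
      totalDegree_eq_zero_iff_eq_C.mp (Nat.le_zero.mp ha.totalDegree_le)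
    rw [hc, show coeff 0 a = 0 from h, C_0]

end HomPart

variable {K : Type*} [Field K] {r : ℕ}

lemma mem_span_X_inl_iff {t : Set (Fin (r + 1))} {c : SpaceRing K r} :
    c ∈ Ideal.span ((fun j => (X (Sum.inl j) : SpaceRing K r)) '' t) ↔
      ∃ y : Fin (r + 1) → SpaceRing K r, (∀ j ∉ t, y j = 0) ∧ c = ∑ j, y j * X (Sum.inl j) := by
  constructor
  · intro h
    induction h using Submodule.span_induction with
    | mem x hx =>
      obtain ⟨j, hj, rfl⟩ := hx
      refine ⟨Pi.single j 1, fun i hi => ?_, by simp [Pi.single_apply]⟩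
      exact Pi.single_eq_of_ne (by rintro rfl; exact hi hj) _
    | zero => exact ⟨0, by simp, by simp⟩
    | add x y _ _ hx hy =>
      obtain ⟨a, ha, rfl⟩ := hx
      obtain ⟨b, hb, rfl⟩ := hy
      exact ⟨a + b, fun j hj => by simp [ha j hj, hb j hj],
        by simp [add_mul, Finset.sum_add_distrib]⟩
    | smul a x _ hx =>
      obtain ⟨b, hb, rfl⟩ := hx
      exact ⟨a • b, fun j hj => by simp [hb j hj], by simp [Finset.mul_sum, mul_assoc]⟩
  · rintro ⟨y, hy, rfl⟩
    refine Submodule.sum_mem _ fun j _ => ?_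
    by_cases hj : j ∈ t
    · exact Ideal.mul_mem_left _ _ (Ideal.subset_span ⟨j, hj, rfl⟩)
    · rw [hy j hj, zero_mul]
      exact Submodule.zero_mem _

/-- Membership in an ideal generated by variables is tested monomial by monomial, and multiplication
by `x_p` does not affect the exponents of the other variables. -/
lemma isWeaklyRegularFamily_X_inl :
    IsWeaklyRegularFamily (fun l : Fin (r + 1) => (X (Sum.inl l) : SpaceRing K r)) := by
  intro p c y hy hc
  have h1 : X (Sum.inl p) * c ∈
      Ideal.span ((fun j => (X (Sum.inl j) : SpaceRing K r)) '' {j | ¬ p ≤ j}) :=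
    mem_span_X_inl_iff.mpr ⟨y, fun j hj => hy j (by simpa using hj), hc⟩
  have h2 : c ∈ Ideal.span ((fun j => (X (Sum.inl j) : SpaceRing K r)) '' {j | ¬ p ≤ j}) := by
    have himg : (fun j => (X (Sum.inl j) : SpaceRing K r)) '' {j | ¬ p ≤ j} =
        X '' (Sum.inl '' {j : Fin (r + 1) | ¬ p ≤ j}) := by
      rw [Set.image_image]
    rw [himg, mem_ideal_span_X_image] at h1 ⊢
    intro m hm
    obtain ⟨i, ⟨j, hj, rfl⟩, hi⟩ := h1 (Finsupp.single (Sum.inl p) 1 + m) (by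
      rw [mem_support_iff, coeff_X_mul]
      exact mem_support_iff.mp hm)
    refine ⟨_, ⟨j, hj, rfl⟩, ?_⟩
    have hne : (Sum.inl j : Fin (r + 1) ⊕ Fin 2) ≠ Sum.inl p := by
      rintro ⟨⟩
      exact hj le_rfl
    simpa [Finsupp.single_eq_of_ne hne] using hi
  obtain ⟨y', hy', h⟩ := mem_span_X_inl_iff.mp h2
  exact ⟨y', fun j hj => hy' j (by simpa using hj), h⟩

lemma mem_lineIdeal_iff {c : SpaceRing K r} :
    c ∈ lineIdeal K r ↔ ∃ y : Fin (r + 1) → SpaceRing K r, c = ∑ j, X (Sum.inl j) * y j := by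
  rw [lineIdeal, ← Set.image_univ, mem_span_X_inl_iff]
  simp [mul_comm]

/-! ### The graded pieces of the Koszul complex -/

section Graded

/-- The standard basis of `⋀^j Rᴺ`. -/
abbrev koszulBasis (R : Type*) [CommRing R] (N j : ℕ) :
    Module.Basis (Set.powersetCard (Fin N) j) R (⋀[R]^j (Fin N → R)) :=
  (Pi.basisFun R (Fin N)).exteriorPower j

/-- Only the shape of the formula matters: each coefficient is, up to sign, one entry of `v`. This
gives both the degrees of the maps and the ideal containing their images. -/
lemma exists_koszulMap_basis {R : Type*} [CommRing R] {N : ℕ} (j : ℕ)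
    (s : Set.powersetCard (Fin N) (j + 1)) :
    ∃ (f : Fin (j + 1) → Fin N) (g : Fin (j + 1) → Set.powersetCard (Fin N) j),
      ∀ v : Fin N → R, koszulMap v j (koszulBasis R N (j + 1) s) =
        ∑ i : Fin (j + 1), (-1 : ℤ) ^ (i : ℕ) • v (f i) • koszulBasis R N j (g i) := by
  refine ⟨Set.powersetCard.ofFinEmbEquiv.symm s, fun i => Set.powersetCard.ofFinEmbEquiv
    ((Fin.succAboveOrderEmb i).trans (Set.powersetCard.ofFinEmbEquiv.symm s)), fun v => ?_⟩
  rw [koszulBasis, exteriorPower.basis_apply, exteriorPower.ιMulti_family, koszulMap,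
    exteriorPower.alternatingMapLinearEquiv_apply_ιMulti,
    AlternatingMap.alternatizeUncurryFin_apply]
  refine Finset.sum_congr rfl fun i _ => ?_
  rw [exteriorPower.basis_apply, exteriorPower.ιMulti_family, Equiv.symm_apply_apply]
  simp only [LinearMap.smulRight_apply, AlternatingMap.smul_apply, Function.comp_apply,
    Fintype.linearCombination_apply, Pi.basisFun_apply]
  congr 2
  · simp [Pi.single_apply]

variable (j : ℕ)

lemma mem_koszulPart_iff {c d : ℤ} {ω : KoszulTerm K r j} :
    ω ∈ koszulPart K r j c d ↔
      ∀ s, (koszulBasis (SpaceRing K r) (r + 1) j).repr ω s ∈ homPart _ K (d + c - j) :=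
  Iff.rfl

lemma smul_basis_mem_koszulPart {c d e : ℤ} {a : SpaceRing K r} (ha : a ∈ homPart _ K e)
    (s : Set.powersetCard (Fin (r + 1)) j) (h : e = d + c - j) :
    a • koszulBasis (SpaceRing K r) (r + 1) j s ∈ koszulPart K r j c d := by
  classical
  rw [mem_koszulPart_iff]
  intro t
  rw [map_smul, Module.Basis.repr_self, Finsupp.smul_apply, Finsupp.single_apply, ← h]
  split_ifs
  · simpa using ha
  · simp

/-- Basis vectors of `P` have degree `1`, so entries of degree `e` change the twist by `e - 1`. For
`v = x` there is no change; for the `i`-th row of `A` the twist goes from `0` to `α_i - 1`. -/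
lemma koszulMap_mem_koszulPart {v : Fin (r + 1) → SpaceRing K r} {e : ℤ}
    (hv : ∀ l, v l ∈ homPart _ K e) {c c' d : ℤ} (hc : c' = c + e - 1) {ω : KoszulTerm K r (j + 1)}
    (hω : ω ∈ koszulPart K r (j + 1) c d) : koszulMap v j ω ∈ koszulPart K r j c' d := by
  classical
  rw [← (koszulBasis (SpaceRing K r) (r + 1) (j + 1)).sum_repr ω, map_sum]
  refine AddSubgroup.sum_mem _ fun s _ => ?_
  obtain ⟨f, g, h⟩ := exists_koszulMap_basis (R := SpaceRing K r) j s
  rw [map_smul, h, Finset.smul_sum]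
  refine AddSubgroup.sum_mem _ fun i _ => ?_
  rw [smul_comm, ← mul_smul]
  refine AddSubgroup.zsmul_mem _ (smul_basis_mem_koszulPart j
    (mul_mem_homPart_add ((mem_koszulPart_iff _).mp hω s) (hv _)) _ ?_) _
  push_cast
  rw [hc]
  ring

lemma koszulMap_mem_smul_top {R : Type*} [CommRing R] {N : ℕ} {v : Fin N → R} {J : Ideal R}
    (hv : ∀ l, v l ∈ J) (ω : ⋀[R]^(j + 1) (Fin N → R)) :
    koszulMap v j ω ∈ J • (⊤ : Submodule R (⋀[R]^j (Fin N → R))) := by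
  classical
  rw [← (koszulBasis R N (j + 1)).sum_repr ω, map_sum]
  refine Submodule.sum_mem _ fun s _ => ?_
  obtain ⟨f, g, h⟩ := exists_koszulMap_basis (R := R) j s
  rw [map_smul, h]
  refine Submodule.smul_mem _ _ (Submodule.sum_mem _ fun i _ => ?_)
  exact zsmul_mem (Submodule.smul_mem_smul (hv _) Submodule.mem_top) _

lemma zeroEquiv_mem_homPart {c d : ℤ} {ω : KoszulTerm K r 0} (hω : ω ∈ koszulPart K r 0 c d) :
    exteriorPower.zeroEquiv (SpaceRing K r) (Fin (r + 1) → SpaceRing K r) ω ∈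
      homPart _ K (d + c) := by
  rw [← (koszulBasis (SpaceRing K r) (r + 1) 0).sum_repr ω, map_sum]
  refine Submodule.sum_mem _ fun s _ => ?_
  rw [map_smul, exteriorPower.basis_apply, exteriorPower.ιMulti_family,
    exteriorPower.zeroEquiv_ιMulti, smul_eq_mul, mul_one]
  simpa using (mem_koszulPart_iff _).mp hω s

lemma isGradedFree_termPart {m : ℕ} (α : Fin m → ℤ) : IsGradedFree K r (termPart K r α j) := by
  classical
  let b := Pi.basis fun _ : Option (Fin m) => koszulBasis (SpaceRing K r) (r + 1) j
  let e := Fintype.equivFin (Σ _ : Option (Fin m), Set.powersetCard (Fin (r + 1)) j)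
  refine ⟨_, b.reindex e, fun i => j - (extDegree α (e.symm i).1 - 1), fun d x => ?_⟩
  have : x ∈ termPart K r α j d ↔ ∀ i, x i ∈ koszulPart K r j (extDegree α i - 1) d := by
    simp [termPart, AddSubgroup.mem_pi]
  rw [this]
  simp only [mem_koszulPart_iff, Module.Basis.repr_reindex_apply]
  rw [← e.forall_congr_right]
  simp only [Equiv.symm_apply_apply, Sigma.forall, b, Pi.basis_repr]
  refine forall_congr' fun i => forall_congr' fun s => ?_
  rw [show d + (extDegree α i - 1) - (j : ℤ) = d - (j - (extDegree α i - 1)) by ring]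

end Graded

/-! ### The complex attached to the matrix `A` -/

section Epsilon

variable {m : ℕ} (A : Matrix (Fin m) (Fin (r + 1)) (LineRing K)) (j : ℕ)

@[simp]
lemma epsilon_apply_none (x : Term K r m (j + 1)) :
    epsilon A j x none = koszulMap (fun l => X (Sum.inl l)) j (x none) := rfl

@[simp]
lemma epsilon_apply_some (x : Term K r m (j + 1)) (i : Fin m) :
    epsilon A j x (some i) = -koszulMap (fun l => incl K r (A i l)) j (x none) +
      koszulMap (fun l => X (Sum.inl l)) j (x (some i)) := rfl

lemma epsilon_mem_termPart {A : Matrix (Fin m) (Fin (r + 1)) (LineRing K)} {α : Fin m → ℤ}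
    (hA : ∀ i l, A i l ∈ homPart _ K (α i)) (d : ℤ) (x : Term K r m (j + 1))
    (hx : x ∈ termPart K r α (j + 1) d) : epsilon A j x ∈ termPart K r α j d := by
  have hx' : ∀ i, x i ∈ koszulPart K r (j + 1) (extDegree α i - 1) d := by
    simpa [termPart, AddSubgroup.mem_pi] using hx
  have hX : ∀ l : Fin (r + 1), (X (Sum.inl l) : SpaceRing K r) ∈ homPart _ K 1 :=
    fun l => X_mem_homPart _
  rintro (_ | i) -
  · rw [epsilon_apply_none]
    exact koszulMap_mem_koszulPart j hX (by ring) (hx' none)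
  · rw [epsilon_apply_some]
    exact AddSubgroup.add_mem _ (AddSubgroup.neg_mem _ (koszulMap_mem_koszulPart j
      (fun l => incl_mem_homPart (hA i l)) (by simp [extDegree]) (hx' none)))
      (koszulMap_mem_koszulPart j hX (by ring) (hx' (some i)))

/-- If `x` is a cycle, its component `-1` is a boundary `δ a`. By anticommutation each `x_i + δ(A_i)
a` is then a Koszul cycle, hence a boundary `δ b_i`, and `(a, b)` is a preimage of `x`. -/
lemma epsilon_exact : Function.Exact (epsilon A (j + 1)) (epsilon A j) := by
  have hex := koszulMap_exact (isWeaklyRegularFamily_X_inl (K := K) (r := r)) j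
  intro x
  constructor
  · intro h
    have h0 := congrFun h none
    rw [epsilon_apply_none] at h0
    obtain ⟨a, ha⟩ := (hex _).mp h0
    have hi : ∀ i, ∃ b, koszulMap (fun l => X (Sum.inl l)) (j + 1) b =
        x (some i) + koszulMap (fun l => incl K r (A i l)) (j + 1) a := by
      intro i
      refine (hex _).mp ?_
      have h1 := congrFun h (some i)
      rw [epsilon_apply_some, ← ha, koszulMap_comm, neg_neg] at h1
      rw [map_add]
      exact (add_comm _ _).trans h1
    choose b hb using hi
    refine ⟨fun o => o.elim a b, ?_⟩
    ext o : 1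
    rcases o with _ | i
    · exact ha
    · rw [epsilon_apply_some]
      simp only [Option.elim, hb]
      abel
  · rintro ⟨y, rfl⟩
    ext o : 1
    rcases o with _ | i
    · simp [koszulMap_koszulMap]
    · rw [epsilon_apply_some, epsilon_apply_none, epsilon_apply_some, koszulMap_comm, map_add,
        koszulMap_koszulMap]
      simp

/-- With the index shift, `epsilon A r` is `ε_{r+1} = ε_{n-1}`, the leftmost map. Its kernel is the
image of a term built from `⋀^{r+2} P = 0`. -/
lemma epsilon_injective : Function.Injective (epsilon A r) := by
  have : IsEmpty (Set.powersetCard (Fin (r + 1)) (r + 1 + 1)) := by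
    refine ⟨fun s => ?_⟩
    have h1 := Finset.card_le_univ s.1
    rw [Set.powersetCard.card_eq] at h1
    simp at h1
  rw [injective_iff_map_eq_zero]
  intro x hx
  obtain ⟨y, rfl⟩ := (epsilon_exact A r x).mp hx
  have hy : y = 0 := by
    ext o : 1
    exact (koszulBasis (SpaceRing K r) (r + 1) (r + 1 + 1)).ext_elem fun i => isEmptyElim i
  rw [hy, map_zero]

/-- A nonzero homogeneous entry of degree at most `0` is a nonzero constant, whereas entries of
positive degree have no constant term. -/
lemma isMinimal_epsilon_iff {A : Matrix (Fin m) (Fin (r + 1)) (LineRing K)} {α : Fin m → ℤ}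
    (hA : ∀ i l, A i l ∈ homPart _ K (α i)) (hne : ∀ i, ∃ l, A i l ≠ 0) :
    IsMinimal (epsilon A) ↔ ∀ i, 1 ≤ α i := by
  classical
  set J := Ideal.span (Set.range (X : Fin (r + 1) ⊕ Fin 2 → SpaceRing K r)) with hJ
  constructor
  · intro h i
    by_contra hi
    obtain ⟨l, hl⟩ := hne i
    -- The `i`-th component of `ε_1` of this basis element is `-A_{il}`.
    let x : Term K r m 1 := Pi.single none
      ((exteriorPower.oneEquiv (SpaceRing K r) (Fin (r + 1) → SpaceRing K r)).symm (Pi.single l 1))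
    have h1 : epsilon A 0 x ∈ J • (⊤ : Submodule (SpaceRing K r) (Term K r m 0)) := h 0 ⟨x, rfl⟩
    have h2 := Submodule.smul_top_le_comap_smul_top J
      ((exteriorPower.zeroEquiv (SpaceRing K r) (Fin (r + 1) → SpaceRing K r)).toLinearMap ∘ₗ
        LinearMap.proj (some i)) h1
    have h3 : incl K r (A i l) ∈ J := by
      rw [← neg_mem_iff]
      simpa [x, zeroEquiv_koszulMap, Pi.single_apply] using h2
    rw [mem_span_range_X_iff] at h3
    have h4 := eq_zero_of_mem_homPart_of_constantCoeff (by omega) (incl_mem_homPart (hA i l)) h3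
    exact hl (incl_injective K r (by rw [h4, map_zero]))
  · rintro h j _ ⟨x, rfl⟩
    have hX : ∀ l : Fin (r + 1), (X (Sum.inl l) : SpaceRing K r) ∈ J :=
      fun l => Ideal.subset_span ⟨_, rfl⟩
    have hcomp : ∀ o, epsilon A j x o ∈ J • (⊤ : Submodule (SpaceRing K r) (KoszulTerm K r j)) := by
      rintro (_ | i)
      · exact koszulMap_mem_smul_top j hX _
      · refine Submodule.add_mem _ (Submodule.neg_mem _ (koszulMap_mem_smul_top j (fun l => ?_) _))
          (koszulMap_mem_smul_top j hX _)
        have := h i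
        exact mem_span_range_X_iff.mpr
          (constantCoeff_eq_zero_of_mem_homPart (by omega) (incl_mem_homPart (hA i l)))
    rw [← Finset.univ_sum_single (epsilon A j x)]
    exact Submodule.sum_mem _ fun o _ => Submodule.smul_top_le_comap_smul_top J
      (LinearMap.single (SpaceRing K r) (fun _ => KoszulTerm K r j) o) (hcomp o)

end Epsilon

/-! ### Homogeneous components and homogeneous fractions -/

section Components

variable {σ K : Type*} [Field K]

/-- The homogeneous component of degree `d ∈ ℤ`. -/
def homComponent (σ K : Type*) [Field K] (d : ℤ) : MvPolynomial σ K →ₗ[K] MvPolynomial σ K :=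
  if 0 ≤ d then homogeneousComponent d.toNat else 0

lemma homComponent_mem (d : ℤ) (a : MvPolynomial σ K) : homComponent σ K d a ∈ homPart σ K d := by
  by_cases hd : 0 ≤ d
  · rw [mem_homPart_of_nonneg hd, homComponent, if_pos hd]
    exact homogeneousComponent_isHomogeneous _ _
  · rw [homComponent, if_neg hd]
    exact Submodule.zero_mem _

lemma homComponent_of_mem {d e : ℤ} {a : MvPolynomial σ K} (ha : a ∈ homPart σ K d) :
    homComponent σ K e a = if e = d then a else 0 := by
  by_cases he : 0 ≤ e
  · rw [homComponent, if_pos he]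
    by_cases hd : 0 ≤ d
    · rw [homPart, if_pos hd] at ha
      rw [homogeneousComponent_of_mem ha]
      exact if_congr (by omega) rfl rfl
    · rw [eq_zero_of_mem_homPart_of_neg (by omega) ha, map_zero, ite_self]
  · rw [homComponent, if_neg he, LinearMap.zero_apply]
    split_ifs with h
    · exact (eq_zero_of_mem_homPart_of_neg (by omega) ha).symm
    · rfl

lemma sum_homComponent (a : MvPolynomial σ K) :
    ∑ e ∈ Finset.range (a.totalDegree + 1), homComponent σ K e a = a := by
  conv_rhs => rw [← sum_homogeneousComponent a]
  exact Finset.sum_congr rfl fun e _ => by simp [homComponent]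

lemma homComponent_mul {d : ℤ} {a : MvPolynomial σ K} (ha : a ∈ homPart σ K d) (e : ℤ)
    (b : MvPolynomial σ K) : homComponent σ K (d + e) (a * b) = a * homComponent σ K e b := by
  conv_lhs => rw [← sum_homComponent b]
  conv_rhs => rw [← sum_homComponent b]
  rw [Finset.mul_sum, map_sum, map_sum, Finset.mul_sum]
  refine Finset.sum_congr rfl fun n _ => ?_
  rw [homComponent_of_mem (mul_mem_homPart_add ha (homComponent_mem _ _)),
    homComponent_of_mem (homComponent_mem _ _), mul_ite, mul_zero]
  exact if_congr (by omega) rfl rfl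

lemma mem_homPart_of_homComponent_eq_zero {d : ℤ} {a : MvPolynomial σ K}
    (h : ∀ e, e ≠ d → homComponent σ K e a = 0) : a ∈ homPart σ K d := by
  rw [← sum_homComponent a]
  refine Submodule.sum_mem _ fun e _ => ?_
  by_cases he : (e : ℤ) = d
  · rw [he]
    exact homComponent_mem _ _
  · rw [h _ he]
    exact Submodule.zero_mem _

end Components

section Fractions

variable (K : Type*) [Field K]

/-- The field of fractions of `S`. -/
abbrev LineField : Type _ := FractionRing (LineRing K)

/-- The elements of `S`, homogeneous of degree `d`, in the field of fractions of `S`. -/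
def fracPart (d : ℤ) : AddSubgroup (LineField K) :=
  (homPart (Fin 2) K d).toAddSubgroup.map (algebraMap (LineRing K) (LineField K)).toAddMonoidHom

variable {K}

lemma mul_mem_fracPart {d e : ℤ} {f g : LineField K} (hf : f ∈ fracPart K d)
    (hg : g ∈ fracPart K e) : f * g ∈ fracPart K (d + e) := by
  obtain ⟨a, ha, rfl⟩ := hf
  obtain ⟨b, hb, rfl⟩ := hg
  exact ⟨a * b, mul_mem_homPart_add ha hb, map_mul (algebraMap (LineRing K) (LineField K)) _ _⟩

/-- The shift `c` is needed because the coefficient of `z_i` in an element of degree `d` has degree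
`d + α_i - 1`. -/
lemma eq_zero_of_sum_fracPart_eq_zero {t : Finset ℤ} {f : ℤ → LineField K} {c : ℤ}
    (hf : ∀ d ∈ t, f d ∈ fracPart K (d + c)) (h : ∑ d ∈ t, f d = 0) : ∀ d ∈ t, f d = 0 := by
  choose! a ha hfa using hf
  intro d hd
  have h1 : ∑ d ∈ t, a d = 0 := by
    apply IsFractionRing.injective (LineRing K) (LineField K)
    rw [map_sum, map_zero, ← h]
    exact Finset.sum_congr rfl hfa
  have h2 := congrArg (homComponent (Fin 2) K (d + c)) h1
  rw [map_sum, map_zero, Finset.sum_eq_single_of_mem d hd, homComponent_of_mem (ha d hd),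
    if_pos rfl] at h2
  · rw [← hfa d hd, h2]
    exact map_zero _
  · intro e he hne
    rw [homComponent_of_mem (ha e he), if_neg (by omega)]

/-- A fraction that can be written, for every irreducible `q`, as a homogeneous fraction of
degree `d` with denominator not divisible by `q`, is a homogeneous element of `S`. -/
lemma mem_fracPart_of_forall_irreducible {d : ℤ} {f : LineField K}
    (h : ∀ q : LineRing K, Irreducible q → ∃ (e : ℤ) (a b : LineRing K), a ∈ homPart _ K (d + e) ∧
      b ∈ homPart _ K e ∧ ¬ q ∣ b ∧ algebraMap _ (LineField K) b * f = algebraMap _ _ a) :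
    f ∈ fracPart K d := by
  have hinj := IsFractionRing.injective (LineRing K) (LineField K)
  obtain ⟨a₀, b₀, hrel, hf⟩ := IsFractionRing.exists_reduced_fraction (A := LineRing K) f
  have hf' : f * algebraMap _ _ (b₀ : LineRing K) = algebraMap _ _ a₀ := by
    rw [← hf]
    exact IsLocalization.mk'_spec _ _ _
  have hcross : ∀ a b : LineRing K, algebraMap _ (LineField K) b * f = algebraMap _ _ a →
      b * a₀ = a * b₀ := by
    intro a b hab
    apply hinj
    rw [map_mul, map_mul, ← hf', ← hab]
    ring
  -- An irreducible factor `q` of the reduced denominator would divide `b a₀` but not `b`, hence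
  -- also the numerator `a₀`.
  have hunit : IsUnit (b₀ : LineRing K) := by
    by_contra hb
    obtain ⟨q, hq, hqb⟩ := WfDvdMonoid.exists_irreducible_factor hb (nonZeroDivisors.coe_ne_zero b₀)
    obtain ⟨e, a, b, -, -, hqb', hab⟩ := h q hq
    have h1 : q ∣ b * a₀ := hcross a b hab ▸ hqb.mul_left a
    exact hq.not_isUnit (hrel ((hq.prime.dvd_or_dvd h1).resolve_left hqb') hqb)
  obtain ⟨u, hu⟩ := hunit
  obtain ⟨q, hq⟩ : ∃ q : LineRing K, Irreducible q := ⟨X 0, (X_prime (i := (0 : Fin 2))).irreducible⟩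
  obtain ⟨e, a, b, ha, hb, hqb, hab⟩ := h q hq
  have hb0 : b ≠ 0 := by
    rintro rfl
    exact hqb (dvd_zero q)
  set s : LineRing K := a₀ * (↑u⁻¹ : LineRing K) with hs
  have hsb : s * b₀ = a₀ := by
    rw [hs, ← hu, mul_assoc, Units.inv_mul, mul_one]
  have hsf : algebraMap _ (LineField K) s = f := by
    have h0 : algebraMap (LineRing K) (LineField K) b₀ ≠ 0 := by
      rw [← hu]
      exact (u.isUnit.map _).ne_zero
    apply mul_right_cancel₀ h0
    rw [hf', ← map_mul, hsb]
  -- Comparing components in `b s = a`, with `a` and `b` homogeneous and `b ≠ 0`, leaves only the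
  -- component of `s` of degree `d`.
  refine ⟨s, mem_homPart_of_homComponent_eq_zero fun n hn => ?_, hsf⟩
  have h1 : b * s = a := by
    apply hinj
    rw [map_mul, hsf, hab]
  have h2 := homComponent_mul hb n s
  rw [h1, homComponent_of_mem ha, if_neg (by omega)] at h2
  exact (mul_eq_zero.mp h2.symm).resolve_left hb0

end Fractions

/-! ### Restriction to the line -/

section Restriction

variable {K : Type*} [Field K] {r : ℕ}

/-- The restriction `R → S`, `x_j ↦ 0`, of polynomials to the line `L`. -/
def lineRestrict (K : Type*) [Field K] (r : ℕ) : SpaceRing K r →ₐ[K] LineRing K :=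
  aeval (Sum.elim (fun _ => 0) X)

@[simp]
lemma lineRestrict_X_inl (l : Fin (r + 1)) : lineRestrict K r (X (Sum.inl l)) = 0 := by
  simp [lineRestrict]

@[simp]
lemma lineRestrict_X_inr (l : Fin 2) : lineRestrict K r (X (Sum.inr l)) = X l := by
  simp [lineRestrict]

@[simp]
lemma lineRestrict_incl (a : LineRing K) : lineRestrict K r (incl K r a) = a := by
  have : (lineRestrict K r).comp (incl K r) = AlgHom.id K _ := by
    ext l
    simp [incl]
  exact DFunLike.congr_fun this a

lemma X_inl_mem_lineIdeal (l : Fin (r + 1)) :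
    (X (Sum.inl l) : SpaceRing K r) ∈ lineIdeal K r :=
  Ideal.subset_span ⟨l, rfl⟩

lemma sub_incl_lineRestrict_mem (a : SpaceRing K r) :
    a - incl K r (lineRestrict K r a) ∈ lineIdeal K r := by
  rw [← Ideal.Quotient.mk_eq_mk_iff_sub_mem]
  have : (Ideal.Quotient.mkₐ K (lineIdeal K r)) =
      (Ideal.Quotient.mkₐ K (lineIdeal K r)).comp ((incl K r).comp (lineRestrict K r)) := by
    ext l
    rcases l with l | l
    · simp [Ideal.Quotient.eq_zero_iff_mem.mpr (X_inl_mem_lineIdeal l)]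
    · simp [incl]
  exact DFunLike.congr_fun this a

lemma lineRestrict_eq_zero_iff {a : SpaceRing K r} :
    lineRestrict K r a = 0 ↔ a ∈ lineIdeal K r := by
  constructor
  · intro h
    have := sub_incl_lineRestrict_mem a
    rwa [h, map_zero, sub_zero] at this
  · intro h
    obtain ⟨y, rfl⟩ := mem_lineIdeal_iff.mp h
    simp

/-- The coefficients of the `x_l` matter only modulo `I_L`, so they may be replaced by their
restrictions to the line. -/
lemma exists_sub_sum_mem_sq {a : SpaceRing K r} (ha : a ∈ lineIdeal K r) :
    ∃ w : Fin (r + 1) → LineRing K,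
      a - ∑ l, X (Sum.inl l) * incl K r (w l) ∈ lineIdeal K r ^ 2 := by
  obtain ⟨y, rfl⟩ := mem_lineIdeal_iff.mp ha
  refine ⟨fun l => lineRestrict K r (y l), ?_⟩
  rw [← Finset.sum_sub_distrib]
  refine Submodule.sum_mem _ fun l _ => ?_
  rw [← mul_sub, pow_two]
  exact Ideal.mul_mem_mul (X_inl_mem_lineIdeal l) (sub_incl_lineRestrict_mem _)

lemma lineRestrict_mem_homPart {d : ℤ} {a : SpaceRing K r} (ha : a ∈ homPart _ K d) :
    lineRestrict K r a ∈ homPart _ K d := by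
  by_cases hd : 0 ≤ d
  · rw [mem_homPart_of_nonneg hd] at ha ⊢
    have := ha.aeval (g := (Sum.elim (fun _ : Fin (r + 1) => (0 : LineRing K)) X)) (n := 1) (by
      rintro (l | l)
      · exact isHomogeneous_zero _ _ _
      · exact isHomogeneous_X _ _)
    rwa [one_mul] at this
  · rw [eq_zero_of_mem_homPart_of_neg (by omega) ha, map_zero]
    exact Submodule.zero_mem _

end Restriction

/-! ### The generic stalk -/

section GenericStalk

variable {K : Type*} [Field K] {r m : ℕ}

/-- The stalk of `⨁_d 𝒪_C(d)` at the generic point of `C`, described by the matrix `A`: the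
elements of degree zero in the variables `x_l`, and `m` copies `z_i` of the field of fractions of
`S`, where `x_l = ∑_i A_{il} z_i`. -/
def GenericStalk (_ : Matrix (Fin m) (Fin (r + 1)) (LineRing K)) : Type _ :=
  TrivSqZeroExt (LineField K) (Fin m → LineField K)

variable (A : Matrix (Fin m) (Fin (r + 1)) (LineRing K))

namespace GenericStalk

instance : CommRing (GenericStalk A) :=
  inferInstanceAs (CommRing (TrivSqZeroExt (LineField K) (Fin m → LineField K)))

/-- The map from `R` to the generic stalk. -/
def ofPoly : SpaceRing K r →ₐ[K] TrivSqZeroExt (LineField K) (Fin m → LineField K) :=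
  aeval (Sum.elim
    (fun l => TrivSqZeroExt.inr fun i => algebraMap (LineRing K) (LineField K) (A i l))
    fun l => TrivSqZeroExt.inl (algebraMap (LineRing K) (LineField K) (X l)))

lemma ofPoly_X_inl (l : Fin (r + 1)) : ofPoly A (X (Sum.inl l)) =
    TrivSqZeroExt.inr fun i => algebraMap (LineRing K) (LineField K) (A i l) := by
  simp [ofPoly]

lemma ofPoly_incl (a : LineRing K) :
    ofPoly A (incl K r a) = TrivSqZeroExt.inl (algebraMap (LineRing K) (LineField K) a) := by
  have : (ofPoly A).comp (incl K r) =
      (TrivSqZeroExt.inlAlgHom K (LineField K) (Fin m → LineField K)).comp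
        (IsScalarTower.toAlgHom K (LineRing K) (LineField K)) := by
    ext l : 1
    simp [incl, ofPoly]
  exact DFunLike.congr_fun this a

instance : Algebra (SpaceRing K r) (GenericStalk A) := (ofPoly A).toRingHom.toAlgebra

variable {A}

/-- The coefficient of `1`. -/
def fst (τ : GenericStalk A) : LineField K := TrivSqZeroExt.fst τ

/-- The coefficient of `z_i`. -/
def snd (τ : GenericStalk A) (i : Fin m) : LineField K := TrivSqZeroExt.snd τ i

variable (A) in
/-- The elements `z_i`. -/
def z (i : Fin m) : GenericStalk A := TrivSqZeroExt.inr (Pi.single i 1)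

@[ext]
lemma ext {τ υ : GenericStalk A} (h : τ.fst = υ.fst) (h' : ∀ i, τ.snd i = υ.snd i) : τ = υ :=
  TrivSqZeroExt.ext h (funext h')

@[simp] lemma fst_zero : (0 : GenericStalk A).fst = 0 := rfl
@[simp] lemma snd_zero (i : Fin m) : (0 : GenericStalk A).snd i = 0 := rfl
@[simp] lemma fst_one : (1 : GenericStalk A).fst = 1 := rfl
@[simp] lemma snd_one (i : Fin m) : (1 : GenericStalk A).snd i = 0 := rfl
@[simp] lemma fst_add (τ υ : GenericStalk A) : (τ + υ).fst = τ.fst + υ.fst := rfl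
@[simp] lemma snd_add (τ υ : GenericStalk A) (i : Fin m) :
    (τ + υ).snd i = τ.snd i + υ.snd i := rfl
@[simp] lemma fst_mul (τ υ : GenericStalk A) : (τ * υ).fst = τ.fst * υ.fst := rfl
@[simp] lemma snd_mul (τ υ : GenericStalk A) (i : Fin m) :
    (τ * υ).snd i = τ.fst * υ.snd i + υ.fst * τ.snd i := by
  change τ.fst * υ.snd i + τ.snd i * υ.fst = _
  rw [mul_comm υ.fst]
@[simp] lemma fst_z (i : Fin m) : (z A i).fst = 0 := rfl
@[simp] lemma snd_z (i l : Fin m) : (z A i).snd l = if l = i then 1 else 0 := by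
  simp [z, snd, Pi.single_apply]

@[simp] lemma fst_sum {ι : Type*} (t : Finset ι) (f : ι → GenericStalk A) :
    (∑ i ∈ t, f i).fst = ∑ i ∈ t, (f i).fst :=
  map_sum ({ toFun := fst, map_zero' := rfl, map_add' := fun _ _ => rfl } :
    GenericStalk A →+ LineField K) f t

@[simp] lemma snd_sum {ι : Type*} (t : Finset ι) (f : ι → GenericStalk A) (l : Fin m) :
    (∑ i ∈ t, f i).snd l = ∑ i ∈ t, (f i).snd l :=
  map_sum ({ toFun := fun τ => snd τ l, map_zero' := rfl, map_add' := fun _ _ => rfl } :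
    GenericStalk A →+ LineField K) f t

lemma isUnit_of_fst_ne_zero {τ : GenericStalk A} (h : τ.fst ≠ 0) : IsUnit τ := by
  have : IsUnit (M := TrivSqZeroExt (LineField K) (Fin m → LineField K)) τ :=
    TrivSqZeroExt.isUnit_iff_isUnit_fst.mpr (isUnit_iff_ne_zero.mpr h)
  exact this

lemma algebraMap_X_inl (l : Fin (r + 1)) :
    (algebraMap (SpaceRing K r) (GenericStalk A) (X (Sum.inl l)) : GenericStalk A) =
      TrivSqZeroExt.inr fun i => algebraMap (LineRing K) (LineField K) (A i l) :=
  ofPoly_X_inl A l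

lemma algebraMap_incl (a : LineRing K) :
    (algebraMap (SpaceRing K r) (GenericStalk A) (incl K r a) : GenericStalk A) =
      TrivSqZeroExt.inl (algebraMap (LineRing K) (LineField K) a) :=
  ofPoly_incl A a

@[simp] lemma fst_algebraMap_incl (a : LineRing K) :
    (algebraMap (SpaceRing K r) (GenericStalk A) (incl K r a)).fst = algebraMap _ _ a := by
  rw [algebraMap_incl]; rfl

@[simp] lemma snd_algebraMap_incl (a : LineRing K) (i : Fin m) :
    (algebraMap (SpaceRing K r) (GenericStalk A) (incl K r a)).snd i = 0 := by
  rw [algebraMap_incl]; rfl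

@[simp] lemma fst_algebraMap_X_inl (l : Fin (r + 1)) :
    (algebraMap (SpaceRing K r) (GenericStalk A) (X (Sum.inl l))).fst = 0 := by
  rw [algebraMap_X_inl]; rfl

@[simp] lemma snd_algebraMap_X_inl (l : Fin (r + 1)) (i : Fin m) :
    (algebraMap (SpaceRing K r) (GenericStalk A) (X (Sum.inl l))).snd i =
      algebraMap _ _ (A i l) := by
  rw [algebraMap_X_inl]; rfl

@[simp] lemma fst_algebraMap (a : SpaceRing K r) :
    (algebraMap (SpaceRing K r) (GenericStalk A) a).fst = algebraMap _ _ (lineRestrict K r a) := by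
  obtain ⟨y, hy⟩ := mem_lineIdeal_iff.mp (sub_incl_lineRestrict_mem a)
  rw [eq_add_of_sub_eq hy]
  simp

lemma algebraMap_mem_sq {a : SpaceRing K r} (ha : a ∈ lineIdeal K r ^ 2) :
    algebraMap (SpaceRing K r) (GenericStalk A) a = 0 := by
  rw [pow_two] at ha
  induction ha using Submodule.mul_induction_on' with
  | mem_mul_mem x hx y hy =>
    rw [← lineRestrict_eq_zero_iff] at hx hy
    ext <;> simp [hx, hy]
  | add x _ y _ hx hy => rw [map_add, hx, hy, add_zero]

/-- The homogeneous part of degree `d` of `S ⊕ ⨁_i S z_i`, where `z_i` has degree `1 - α_i`. -/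
def part (A : Matrix (Fin m) (Fin (r + 1)) (LineRing K)) (α : Fin m → ℤ) (d : ℤ) :
    AddSubgroup (GenericStalk A) where
  carrier := {τ | τ.fst ∈ fracPart K d ∧ ∀ i, τ.snd i ∈ fracPart K (d + (α i - 1))}
  zero_mem' := ⟨AddSubgroup.zero_mem _, fun _ => AddSubgroup.zero_mem _⟩
  add_mem' h h' := ⟨AddSubgroup.add_mem _ h.1 h'.1, fun i => AddSubgroup.add_mem _ (h.2 i) (h'.2 i)⟩
  neg_mem' h := ⟨AddSubgroup.neg_mem _ h.1, fun i => AddSubgroup.neg_mem _ (h.2 i)⟩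

lemma mul_mem_part {α : Fin m → ℤ} {d e : ℤ} {τ υ : GenericStalk A} (hτ : τ ∈ part A α d)
    (hυ : υ ∈ part A α e) : τ * υ ∈ part A α (d + e) := by
  refine ⟨mul_mem_fracPart hτ.1 hυ.1, fun i => ?_⟩
  rw [snd_mul]
  refine AddSubgroup.add_mem _ ?_ ?_
  · rw [add_assoc]
    exact mul_mem_fracPart hτ.1 (hυ.2 i)
  · rw [add_comm d, add_assoc]
    exact mul_mem_fracPart hυ.1 (hτ.2 i)

lemma algebraMap_incl_mem_part {α : Fin m → ℤ} {d : ℤ} {a : LineRing K} (ha : a ∈ homPart _ K d) :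
    algebraMap (SpaceRing K r) (GenericStalk A) (incl K r a) ∈ part A α d := by
  refine ⟨?_, fun i => ?_⟩
  · rw [fst_algebraMap_incl]
    exact ⟨a, ha, rfl⟩
  · rw [snd_algebraMap_incl]
    exact AddSubgroup.zero_mem _

/-- The image `∑_i A_{il} z_i` of `x_l` has degree `α_i + (1 - α_i) = 1`. -/
lemma algebraMap_X_mem_part {α : Fin m → ℤ} (hA : ∀ i l, A i l ∈ homPart _ K (α i))
    (l : Fin (r + 1) ⊕ Fin 2) :
    algebraMap (SpaceRing K r) (GenericStalk A) (X l) ∈ part A α 1 := by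
  rcases l with l | l
  · refine ⟨?_, fun i => ?_⟩
    · rw [fst_algebraMap_X_inl]
      exact AddSubgroup.zero_mem _
    · rw [snd_algebraMap_X_inl]
      exact ⟨A i l, by rw [add_sub_cancel]; exact hA i l, rfl⟩
  · have := algebraMap_incl_mem_part (A := A) (α := α) (X_mem_homPart (K := K) l)
    rwa [incl, rename_X] at this

lemma algebraMap_monomial_mem_part {α : Fin m → ℤ} (hA : ∀ i l, A i l ∈ homPart _ K (α i))
    (u : (Fin (r + 1) ⊕ Fin 2) →₀ ℕ) (c : K) :
    algebraMap (SpaceRing K r) (GenericStalk A) (monomial u c) ∈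
      part A α (Finsupp.weight (1 : Fin (r + 1) ⊕ Fin 2 → ℕ) u : ℕ) := by
  have hC : ∀ c : K, algebraMap (SpaceRing K r) (GenericStalk A) (C c) ∈ part A α 0 := by
    intro c
    have : C c ∈ homPart (Fin 2) K 0 := by
      rw [mem_homPart_of_nonneg le_rfl]
      exact isHomogeneous_C _ _
    have h := algebraMap_incl_mem_part (A := A) (α := α) this
    rwa [incl, rename_C] at h
  induction u using Finsupp.induction_linear generalizing c with
  | zero => simpa using hC c
  | add u v hu hv =>
    rw [← mul_one c, ← monomial_mul, map_mul, map_add, Nat.cast_add]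
    exact mul_mem_part (hu c) (hv 1)
  | single l n =>
    rw [← C_mul_X_pow_eq_monomial, map_mul, map_pow]
    have hpow : ∀ n : ℕ, algebraMap (SpaceRing K r) (GenericStalk A) (X l) ^ n ∈
        part A α (n : ℤ) := by
      intro n
      induction n with
      | zero =>
        rw [pow_zero, ← map_one (algebraMap (SpaceRing K r) (GenericStalk A)), ← C_1]
        exact hC 1
      | succ n ih =>
        rw [pow_succ, Nat.cast_succ]
        exact mul_mem_part ih (algebraMap_X_mem_part hA l)
    have := mul_mem_part (hC c) (hpow n)
    rw [zero_add] at this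
    simpa [Finsupp.weight_single] using this

lemma algebraMap_mem_part {α : Fin m → ℤ} (hA : ∀ i l, A i l ∈ homPart _ K (α i)) {d : ℤ}
    {a : SpaceRing K r} (ha : a ∈ homPart _ K d) :
    algebraMap (SpaceRing K r) (GenericStalk A) a ∈ part A α d := by
  by_cases hd : 0 ≤ d
  · lift d to ℕ using hd
    rw [homPart_natCast, mem_homogeneousSubmodule] at ha
    rw [a.as_sum, map_sum]
    refine AddSubgroup.sum_mem _ fun u hu => ?_
    rw [← ha (mem_support_iff.mp hu)]
    exact algebraMap_monomial_mem_part hA _ _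
  · rw [eq_zero_of_mem_homPart_of_neg (by omega) ha, map_zero]
    exact AddSubgroup.zero_mem _

end GenericStalk

end GenericStalk

/-! ### The points of a rope -/

section PointsOfRope

variable {K : Type*} [Field K] {r : ℕ} {I : Ideal (SpaceRing K r)}

/-- The homogeneous prime ideal of a point. -/
abbrev Points.ideal (p : Points I) : Ideal (SpaceRing K r) := p.1.asHomogeneousIdeal.toIdeal

lemma Points.le_ideal (p : Points I) : I ≤ p.ideal := p.2

lemma Points.lineIdeal_le (hsq : lineIdeal K r ^ 2 ≤ I) (p : Points I) :
    lineIdeal K r ≤ p.ideal :=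
  p.1.isPrime.le_of_pow_le (hsq.trans p.le_ideal)

lemma irrelevant_le_of_X_mem {σ K : Type*} [Field K]
    {J : HomogeneousIdeal (homogeneousSubmodule σ K)} (h : ∀ i, X i ∈ J.toIdeal) :
    HomogeneousIdeal.irrelevant (homogeneousSubmodule σ K) ≤ J := by
  intro a ha
  have h0 : constantCoeff a = 0 := by
    have h1 := (HomogeneousIdeal.mem_irrelevant_iff _ _).mp ha
    have h2 : homogeneousComponent 0 a = 0 := by
      rw [← h1]
      exact (decomposition.decompose'_apply a 0).symm
    rw [homogeneousComponent_zero, C_eq_zero] at h2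
    exact h2
  have hle : Ideal.span (Set.range (X : σ → MvPolynomial σ K)) ≤ J.toIdeal := by
    rw [Ideal.span_le]
    rintro _ ⟨i, rfl⟩
    exact h i
  exact hle (mem_span_range_X_iff.mpr h0)

lemma X_mem_irrelevant {σ K : Type*} [Field K] (i : σ) :
    (X i : MvPolynomial σ K) ∈ HomogeneousIdeal.irrelevant (homogeneousSubmodule σ K) :=
  HomogeneousIdeal.mem_irrelevant_of_mem _ one_pos (isHomogeneous_X K i)

/-- The inclusion `S ⊆ R` as a homomorphism of graded rings. -/
def gradedIncl (K : Type*) [Field K] (r : ℕ) :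
    GradedRingHom (homogeneousSubmodule (Fin 2) K)
      (homogeneousSubmodule (Fin (r + 1) ⊕ Fin 2) K) where
  toRingHom := (incl K r).toRingHom
  map_mem h := IsHomogeneous.rename_isHomogeneous h

/-- The points of a rope as points of the line. -/
def Points.toLine (hsq : lineIdeal K r ^ 2 ≤ I) (p : Points I) :
    ProjectiveSpectrum (homogeneousSubmodule (Fin 2) K) where
  asHomogeneousIdeal := p.1.asHomogeneousIdeal.comap (gradedIncl K r)
  isPrime := p.1.isPrime.comap (gradedIncl K r)
  not_irrelevant_le h := by
    refine p.1.not_irrelevant_le (irrelevant_le_of_X_mem ?_)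
    rintro (l | l)
    · exact p.lineIdeal_le hsq (X_inl_mem_lineIdeal l)
    · have h1 : incl K r (X l) ∈ p.ideal := h (X_mem_irrelevant l)
      rwa [incl, rename_X] at h1

/-- The generic point of a rope. -/
def genericPoint (hle : I ≤ lineIdeal K r) : Points I where
  val :=
    { asHomogeneousIdeal := ⟨lineIdeal K r, Ideal.homogeneous_span _ _ (by
        rintro _ ⟨l, rfl⟩
        exact ⟨1, isHomogeneous_X K _⟩)⟩
      isPrime := by
        have : lineIdeal K r = RingHom.ker (lineRestrict K r) := by
          ext a
          rw [RingHom.mem_ker, lineRestrict_eq_zero_iff]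
        change (lineIdeal K r).IsPrime
        rw [this]
        exact RingHom.ker_isPrime _
      not_irrelevant_le := fun h => by
        have h1 : X (Sum.inr 0) ∈ lineIdeal K r := h (X_mem_irrelevant _)
        rw [← lineRestrict_eq_zero_iff, lineRestrict_X_inr] at h1
        exact X_ne_zero _ h1 }
  property := hle

lemma genericPoint_mem_of_isOpen (hsq : lineIdeal K r ^ 2 ≤ I) (hle : I ≤ lineIdeal K r)
    {U : Set (Points I)} (hU : IsOpen U) {p : Points I} (hp : p ∈ U) :
    genericPoint hle ∈ U := by
  have h : (genericPoint hle).1 ≤ p.1 := p.lineIdeal_le hsq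
  rw [ProjectiveSpectrum.le_iff_mem_closure, ← specializes_iff_mem_closure] at h
  exact (Topology.IsInducing.subtypeVal.specializes_iff.mp h).mem_open hU hp

/-- As `q` need not be homogeneous, the point is the homogeneous core of the preimage of `(q)`. A
homogeneous `b` outside the core lies outside the preimage as well. -/
lemma exists_point_of_irreducible (hle : I ≤ lineIdeal K r) {q : LineRing K} (hq : Irreducible q) :
    ∃ p : Points I, ∀ (e : ℕ) (b : SpaceRing K r), b ∈ homogeneousSubmodule _ K e → b ∉ p.ideal →
      ¬ q ∣ lineRestrict K r b := by
  have hprime : (Ideal.span {q}).IsPrime := (Ideal.span_singleton_prime hq.ne_zero).mpr hq.prime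
  set J : Ideal (SpaceRing K r) := (Ideal.span {q}).comap (lineRestrict K r) with hJ
  have hJp : J.IsPrime := hprime.comap _
  have hmemJ : ∀ a, a ∈ J ↔ q ∣ lineRestrict K r a := fun a => by
    rw [hJ, Ideal.mem_comap, Ideal.mem_span_singleton]
  have hcore : (J.homogeneousCore (homogeneousSubmodule _ K)).toIdeal ≤ J :=
    Ideal.toIdeal_homogeneousCore_le _ J
  have hline : lineIdeal K r ≤ (J.homogeneousCore (homogeneousSubmodule _ K)).toIdeal := by
    rw [lineIdeal, Ideal.span_le]
    rintro _ ⟨l, rfl⟩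
    refine Ideal.mem_homogeneousCore_of_homogeneous_of_mem ⟨1, isHomogeneous_X K _⟩ ?_
    rw [hmemJ]
    simp
  refine ⟨⟨⟨J.homogeneousCore _, hJp.homogeneousCore, fun h => ?_⟩, hle.trans hline⟩,
    fun e b hb hbp hqb => hbp ?_⟩
  · have h1 : ∀ l : Fin 2, q ∣ X l := by
      intro l
      have := (hmemJ _).mp (hcore (h (X_mem_irrelevant (Sum.inr l))))
      rwa [lineRestrict_X_inr] at this
    have h2 : Associated (X 0 : LineRing K) (X 1) :=
      ((hq.associated_of_dvd X_prime.irreducible (h1 0)).symm).trans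
        (hq.associated_of_dvd X_prime.irreducible (h1 1))
    -- If `q` divided both `t` and `u`, then `t ∣ u`; evaluation at `t = 0`, `u = 1` would give `0 ∣
    -- 1`.
    have h3 := map_dvd (aeval (fun l : Fin 2 => if l = 0 then (0 : K) else 1)) h2.dvd
    simp at h3
  · exact Ideal.mem_homogeneousCore_of_homogeneous_of_mem ⟨e, hb⟩ ((hmemJ b).mpr hqb)

end PointsOfRope

/-! ### Consequences of the local exactness -/

section Local

variable {K : Type*} [Field K] {r m k : ℕ} {I : Ideal (SpaceRing K r)} {α : Fin m → ℤ}
  {β : Fin k → ℤ} {A : Matrix (Fin m) (Fin (r + 1)) (LineRing K)}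
  {B : Matrix (Fin (r + 1)) (Fin k) (LineRing K)}

namespace IsRelated

variable (h : IsRelated I α β A B)
include h

lemma sq_le : lineIdeal K r ^ 2 ≤ I := h.ideal_eq ▸ le_sup_left

lemma sum_mem (l : Fin k) : ∑ j, X (Sum.inl j) * incl K r (B j l) ∈ I :=
  h.ideal_eq ▸ Ideal.mem_sup_right (Ideal.subset_span ⟨l, rfl⟩)

lemma le_lineIdeal : I ≤ lineIdeal K r := by
  rw [h.ideal_eq, sup_le_iff, Ideal.span_le]
  refine ⟨Ideal.pow_le_self two_ne_zero, ?_⟩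
  rintro _ ⟨l, rfl⟩
  exact Submodule.sum_mem _ fun j _ => Ideal.mul_mem_right _ _ (X_inl_mem_lineIdeal j)

/-- The generic point of the rope. -/
abbrev generic : Points I := genericPoint h.le_lineIdeal

/-- The identity holds in the localization at one point of the line, and `S` embeds in that
localization. -/
lemma sum_mul_eq_zero (i : Fin m) (l : Fin k) : ∑ j, A i j * B j l = 0 := by
  set p := h.generic.toLine h.sq_le
  obtain ⟨-, hex, -⟩ := h.exact p
  have h1 := congrFun (hex.apply_apply_eq_zero (Pi.single l 1)) i
  apply IsLocalization.injective (Localization.AtPrime p.asHomogeneousIdeal.toIdeal)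
    (Ideal.primeCompl_le_nonZeroDivisors p.asHomogeneousIdeal.toIdeal)
  rw [map_zero, map_sum]
  simpa [Matrix.mulVec, dotProduct, Pi.single_apply] using h1

lemma algebraMap_eq_zero {a : SpaceRing K r} (ha : a ∈ I) :
    algebraMap (SpaceRing K r) (GenericStalk A) a = 0 := by
  have hle : I ≤ RingHom.ker (algebraMap (SpaceRing K r) (GenericStalk A)) := by
    rw [h.ideal_eq, sup_le_iff, Ideal.span_le]
    refine ⟨fun b hb => GenericStalk.algebraMap_mem_sq hb, ?_⟩
    rintro _ ⟨l, rfl⟩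
    rw [SetLike.mem_coe, RingHom.mem_ker]
    ext i
    · simp
    · have h1 := congrArg (algebraMap (LineRing K) (LineField K)) (h.sum_mul_eq_zero i l)
      simp only [map_sum, map_mul, map_zero] at h1
      simp only [map_sum, map_mul, GenericStalk.snd_sum, GenericStalk.snd_mul,
        GenericStalk.fst_algebraMap_X_inl, GenericStalk.snd_algebraMap_X_inl,
        GenericStalk.fst_algebraMap_incl, zero_mul, zero_add, GenericStalk.snd_zero]
      rw [← h1]
      exact Finset.sum_congr rfl fun j _ => mul_comm _ _
  exact hle ha

/-- At every point of the rope, an element with image zero in the generic stalk is annihilated by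
an element that does not vanish at the point. -/
lemma exists_mul_mem {a : SpaceRing K r}
    (ha : algebraMap (SpaceRing K r) (GenericStalk A) a = 0) (p : Points I) :
    ∃ c ∉ p.ideal, c * a ∈ I := by
  set P := p.toLine h.sq_le with hP
  have hinjF := IsFractionRing.injective (LineRing K) (LineField K)
  have hinj := IsLocalization.injective (Localization.AtPrime P.asHomogeneousIdeal.toIdeal)
    (Ideal.primeCompl_le_nonZeroDivisors P.asHomogeneousIdeal.toIdeal)
  obtain ⟨-, hex, -⟩ := h.exact P
  have ha0 : a ∈ lineIdeal K r := by
    rw [← lineRestrict_eq_zero_iff]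
    apply hinjF
    rw [← GenericStalk.fst_algebraMap (A := A), ha, map_zero, GenericStalk.fst_zero]
  obtain ⟨w, hw⟩ := exists_sub_sum_mem_sq ha0
  have h0 : algebraMap (SpaceRing K r) (GenericStalk A)
      (∑ l, X (Sum.inl l) * incl K r (w l)) = 0 := by
    have h1 := GenericStalk.algebraMap_mem_sq (A := A) hw
    rwa [map_sub, ha, zero_sub, neg_eq_zero] at h1
  have hAw : ∀ i, ∑ l, A i l * w l = 0 := by
    intro i
    apply hinjF
    have h1 := congrArg (fun τ => GenericStalk.snd τ i) h0
    simp only [map_sum, map_mul, GenericStalk.snd_sum, GenericStalk.snd_mul,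
      GenericStalk.fst_algebraMap_X_inl, GenericStalk.snd_algebraMap_X_inl,
      GenericStalk.fst_algebraMap_incl, zero_mul, zero_add, GenericStalk.snd_zero] at h1
    rw [map_zero, ← h1, map_sum]
    exact Finset.sum_congr rfl fun l _ => by rw [map_mul, mul_comm]
  -- Modulo `I_L²`, `a` is `∑ x_l w_l` with `A w = 0`. Local exactness gives `w = B y`; clearing
  -- denominators, `c w = B y'`, so that `c a` lies in `I`.
  obtain ⟨y, hy⟩ := (hex (fun l => algebraMap _ _ (w l))).mp (by
    ext i
    simp only [Matrix.mulVec, dotProduct, Matrix.map_apply, Pi.zero_apply, ← map_mul, ← map_sum,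
      hAw i, map_zero])
  obtain ⟨c, hc⟩ := IsLocalization.exist_integer_multiples_of_finite
    P.asHomogeneousIdeal.toIdeal.primeCompl y
  choose y' hy' using hc
  have hcw : ∀ l, c * w l = ∑ j, B l j * y' j := by
    intro l
    apply hinj
    rw [map_mul, ← congrFun hy l, map_sum]
    simp only [Matrix.mulVec, dotProduct, Matrix.map_apply, Finset.mul_sum, map_mul, hy',
      Algebra.smul_def]
    exact Finset.sum_congr rfl fun j _ => by ring
  refine ⟨incl K r c, c.2, ?_⟩
  have h2 : incl K r c * a = incl K r c * (a - ∑ l, X (Sum.inl l) * incl K r (w l)) +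
      ∑ j, incl K r (y' j) * ∑ l, X (Sum.inl l) * incl K r (B l j) := by
    have h3 : incl K r c * ∑ l, X (Sum.inl l) * incl K r (w l) =
        ∑ j, incl K r (y' j) * ∑ l, X (Sum.inl l) * incl K r (B l j) := by
      simp only [Finset.mul_sum]
      rw [Finset.sum_comm]
      refine Finset.sum_congr rfl fun l _ => ?_
      rw [mul_left_comm, ← map_mul, hcw, map_sum, Finset.mul_sum]
      exact Finset.sum_congr rfl fun j _ => by rw [map_mul]; ring
    rw [← h3]
    ring
  rw [h2]
  exact I.add_mem (I.mul_mem_left _ (h.sq_le hw))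
    (I.sum_mem fun j _ => I.mul_mem_left _ (h.sum_mem j))

/-- At every point of the rope, `z_i` is a homogeneous fraction of degree `1 - α_i`. -/
lemma exists_fraction (i : Fin m) (p : Points I) :
    ∃ (e : ℕ) (c : LineRing K) (w : Fin (r + 1) → LineRing K), incl K r c ∉ p.ideal ∧
      c ∈ homogeneousSubmodule _ K e ∧ (∀ l, w l ∈ homPart _ K (e - α i)) ∧
      ∀ i', ∑ l, A i' l * w l = if i' = i then c else 0 := by
  classical
  set P := p.toLine h.sq_le with hP
  have hinj := IsLocalization.injective (Localization.AtPrime P.asHomogeneousIdeal.toIdeal)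
    (Ideal.primeCompl_le_nonZeroDivisors P.asHomogeneousIdeal.toIdeal)
  obtain ⟨-, -, hsurj⟩ := h.exact P
  obtain ⟨y, hy⟩ := hsurj (Pi.single i 1)
  obtain ⟨c, hc⟩ := IsLocalization.exist_integer_multiples_of_finite
    P.asHomogeneousIdeal.toIdeal.primeCompl y
  choose w hw using hc
  have hAw : ∀ i', ∑ l, A i' l * w l = if i' = i then (c : LineRing K) else 0 := by
    intro i'
    apply hinj
    have h1 := congrFun hy i'
    simp only [Matrix.mulVec, dotProduct, Matrix.map_apply, Pi.single_apply] at h1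
    rw [map_sum]
    simp only [map_mul, hw, Algebra.smul_def]
    have h2 : ∀ l, algebraMap (LineRing K) (Localization.AtPrime P.asHomogeneousIdeal.toIdeal)
        (A i' l) * (algebraMap _ _ (c : LineRing K) * y l) = algebraMap _ _ (c : LineRing K) *
          (algebraMap _ _ (A i' l) * y l) := fun l => by ring
    simp only [h2]
    rw [← Finset.mul_sum, h1]
    split_ifs <;> simp
  -- So far `A w = c e_i`, with `c` possibly inhomogeneous. Some component of `c` is nonzero at the
  -- point, and the rows of `A` are homogeneous, so the equation can be cut down to that degree.
  obtain ⟨e, he⟩ : ∃ e : ℕ, homComponent _ K e (c : LineRing K) ∉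
      P.asHomogeneousIdeal.toIdeal := by
    by_contra! hall
    refine c.2 ?_
    rw [SetLike.mem_coe, ← sum_homComponent (c : LineRing K)]
    exact Submodule.sum_mem _ fun e _ => hall e
  refine ⟨e, homComponent _ K e c, fun l => homComponent _ K (e - α i) (w l), ?_, ?_,
    fun l => homComponent_mem _ _, fun i' => ?_⟩
  · exact he
  · rw [← homPart_natCast]
    exact homComponent_mem _ _
  · have h1 : ∀ l, A i' l * homComponent _ K (e - α i) (w l) =
        homComponent _ K (α i' + (e - α i)) (A i' l * w l) := fun l =>
      (homComponent_mul (h.homogeneous_left i' l) _ _).symm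
    simp only [h1]
    rw [← map_sum, hAw i']
    split_ifs with hi
    · rw [hi, add_sub_cancel]
    · rw [map_zero]

end IsRelated

end Local

/-! ### The direct sum of the global sections -/

section DirectSumOfSections

variable {K : Type*} [Field K] {r : ℕ} {I : Ideal (SpaceRing K r)}

namespace GlobalSections

variable (I) in
/-- The inclusion `H⁰(C, 𝒪_C(d)) → H⁰_*(C, 𝒪_C)`. -/
def of (d : ℤ) : twistSections I d →+ GlobalSections I :=
  DirectSum.of (fun d : ℤ => twistSections I d) d

lemma exists_sum_of (s : GlobalSections I) :
    ∃ (t : Finset ℤ) (f : ∀ d, twistSections I d), s = ∑ d ∈ t, of I d (f d) := by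
  classical
  exact ⟨_, _, (DirectSum.sum_support_of (β := fun d : ℤ => twistSections I d) s).symm⟩

/-- The additive map with given restrictions to the homogeneous parts. -/
def lift {G : Type*} [AddCommMonoid G] (φ : ∀ d, twistSections I d →+ G) : GlobalSections I →+ G :=
  DirectSum.toAddMonoid (β := fun d : ℤ => twistSections I d) φ

set_option synthInstance.maxHeartbeats 200000 in
lemma lift_of {G : Type*} [AddCommMonoid G] (φ : ∀ d, twistSections I d →+ G) (d : ℤ)
    (s : twistSections I d) : lift φ (of I d s) = φ d s :=
  DFinsupp.liftAddHom_apply_single (β := fun d : ℤ => twistSections I d) φ d s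

set_option synthInstance.maxHeartbeats 200000 in
lemma smul_of {e : ℕ} {f : SpaceRing K r} (hf : f ∈ homogeneousSubmodule _ K e) (d : ℤ)
    (s : twistSections I d) :
    ∃ hs : f • s.1 ∈ twistSections I (e + d), f • of I d s = of I (e + d) ⟨f • s.1, hs⟩ := by
  refine ⟨(gradedSMul I).smul_mem hf s.2, ?_⟩
  have h1 : f • of I d s = DirectSum.Gmodule.smulAddMonoidHom _ _
      (DirectSum.decompose (homogeneousSubmodule (Fin (r + 1) ⊕ Fin 2) K) f) (of I d s) := rfl
  rw [h1, DirectSum.decompose_of_mem _ hf]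
  exact DirectSum.Gmodule.smulAddMonoidHom_apply_of_of _ _ _ _

end GlobalSections

end DirectSumOfSections

/-! ### Evaluation of global sections at the generic point -/

section Evaluation

variable {K : Type*} [Field K] {r m k : ℕ} {I : Ideal (SpaceRing K r)} {α : Fin m → ℤ}
  {β : Fin k → ℤ} {A : Matrix (Fin m) (Fin (r + 1)) (LineRing K)}
  {B : Matrix (Fin (r + 1)) (Fin k) (LineRing K)}

namespace IsRelated

variable (h : IsRelated I α β A B)
include h

lemma lineRestrict_ne_zero {p : Points I} {b : SpaceRing K r} (hb : b ∉ p.ideal) :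
    lineRestrict K r b ≠ 0 := fun h0 =>
  hb (p.lineIdeal_le h.sq_le (lineRestrict_eq_zero_iff.mp h0))

lemma isUnit_algebraMap {p : Points I} {b : SpaceRing K r} (hb : b ∉ p.ideal) :
    IsUnit (algebraMap (SpaceRing K r) (GenericStalk A) b) := by
  apply GenericStalk.isUnit_of_fst_ne_zero
  rw [GenericStalk.fst_algebraMap, map_ne_zero_iff _
    (IsFractionRing.injective (LineRing K) (LineField K))]
  exact h.lineRestrict_ne_zero hb

/-- Equality of fractions at any point can be tested in the generic stalk; this reflects the absence
of embedded points. -/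
lemma mk_eq_mk {p : Points I} {a a' b b' : SpaceRing K r} (hb : b ∈ p.ideal.primeCompl)
    (hb' : b' ∈ p.ideal.primeCompl)
    (hab : algebraMap (SpaceRing K r) (GenericStalk A) (b' * a) = algebraMap _ _ (b * a')) :
    (LocalizedModule.mk (Ideal.Quotient.mk I a) ⟨b, hb⟩ : Stalk I p) =
      LocalizedModule.mk (Ideal.Quotient.mk I a') ⟨b', hb'⟩ := by
  obtain ⟨c, hc, hca⟩ := h.exists_mul_mem (a := b' * a - b * a')
    (by rw [map_sub, hab, sub_self]) p
  rw [LocalizedModule.mk_eq]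
  refine ⟨⟨c, hc⟩, ?_⟩
  have : Ideal.Quotient.mk I (c * (b' * a)) = Ideal.Quotient.mk I (c * (b * a')) := by
    rw [Ideal.Quotient.mk_eq_mk_iff_sub_mem, ← mul_sub]
    exact hca
  exact this

/-- The map from `R / I` to the generic stalk. -/
def quotientEval : (SpaceRing K r ⧸ I) →ₗ[SpaceRing K r] GenericStalk A :=
  (Ideal.Quotient.liftₐ I (Algebra.ofId (SpaceRing K r) (GenericStalk A))
    fun _ ha => h.algebraMap_eq_zero ha).toLinearMap

lemma quotientEval_mk (a : SpaceRing K r) :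
    h.quotientEval (Ideal.Quotient.mk I a) = algebraMap _ _ a := rfl

/-- The map from the stalk at a point to the generic stalk. -/
def stalkEval (p : Points I) : Stalk I p →ₗ[SpaceRing K r] GenericStalk A :=
  LocalizedModule.lift _ h.quotientEval fun b => by
      rw [Module.End.isUnit_iff]
      have hb : ⇑(algebraMap (SpaceRing K r) (Module.End (SpaceRing K r) (GenericStalk A)) b) =
          (algebraMap (SpaceRing K r) (GenericStalk A) b * ·) :=
        funext fun τ => Algebra.smul_def (b : SpaceRing K r) τ
      rw [hb]
      exact IsUnit.isUnit_iff_mulLeft_bijective.mp (h.isUnit_algebraMap b.2)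

lemma algebraMap_mul_stalkEval_mk {p : Points I} (a : SpaceRing K r) (b : p.ideal.primeCompl) :
    algebraMap (SpaceRing K r) (GenericStalk A) b *
      h.stalkEval p (LocalizedModule.mk (Ideal.Quotient.mk I a) b) = algebraMap _ _ a := by
  rw [← Algebra.smul_def, ← map_smul, LocalizedModule.smul'_mk, ← Submonoid.smul_def,
    LocalizedModule.mk_cancel, stalkEval, LocalizedModule.lift_mk_one, quotientEval_mk]

/-- A section and its value at the generic point are given by the same fractions. -/
lemma exists_fraction_of_mem {d : ℤ} {s : ∀ p : Points I, Stalk I p} (hs : s ∈ twistSections I d)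
    (p : Points I) : ∃ (e : ℕ) (a b : SpaceRing K r), a ∈ homPart _ K (d + e) ∧
      b ∈ homogeneousSubmodule _ K e ∧ (∃ hb : b ∈ p.ideal.primeCompl,
        s p = LocalizedModule.mk (Ideal.Quotient.mk I a) ⟨b, hb⟩) ∧
      algebraMap _ _ b * h.stalkEval h.generic (s h.generic) = algebraMap _ _ a := by
  obtain ⟨U, hU, hp, e, a, b, ha, hb, hab⟩ := hs p
  refine ⟨e, a, b, ha, hb, hab p hp, ?_⟩
  obtain ⟨hb', hs'⟩ := hab _ (genericPoint_mem_of_isOpen h.sq_le h.le_lineIdeal hU hp)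
  rw [hs']
  exact h.algebraMap_mul_stalkEval_mk a ⟨b, hb'⟩

lemma eq_zero_of_stalkEval_eq_zero {d : ℤ} {s : ∀ p : Points I, Stalk I p}
    (hs : s ∈ twistSections I d) (h0 : h.stalkEval h.generic (s h.generic) = 0) : s = 0 := by
  funext p
  obtain ⟨e, a, b, -, -, ⟨hb, hsp⟩, hab⟩ := h.exists_fraction_of_mem hs p
  rw [h0, mul_zero] at hab
  rw [hsp, h.mk_eq_mk (a' := 0) (b' := 1) hb (Submonoid.one_mem _) (by
    rw [one_mul, ← hab, mul_zero, map_zero]), map_zero, LocalizedModule.zero_mk]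
  rfl

/-- Each irreducible `q` provides a point near which the section is a fraction whose denominator,
restricted to the line, is prime to `q`. So no denominator survives in the coefficients. -/
lemma stalkEval_mem_part {d : ℤ} {s : ∀ p : Points I, Stalk I p} (hs : s ∈ twistSections I d) :
    h.stalkEval h.generic (s h.generic) ∈ GenericStalk.part A α d := by
  set τ := h.stalkEval h.generic (s h.generic)
  have key : ∀ q : LineRing K, Irreducible q → ∃ (e : ℕ) (a b : SpaceRing K r),
      a ∈ homPart _ K (d + e) ∧ b ∈ homPart _ K (e : ℤ) ∧ ¬ q ∣ lineRestrict K r b ∧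
      algebraMap _ _ b * τ = algebraMap (SpaceRing K r) (GenericStalk A) a := by
    intro q hq
    obtain ⟨p, hp⟩ := exists_point_of_irreducible h.le_lineIdeal hq
    obtain ⟨e, a, b, ha, hb, ⟨hbp, -⟩, hab⟩ := h.exists_fraction_of_mem hs p
    exact ⟨e, a, b, ha, by rwa [homPart_natCast], hp e b hb hbp, hab⟩
  refine ⟨mem_fracPart_of_forall_irreducible fun q hq => ?_,
    fun i => mem_fracPart_of_forall_irreducible fun q hq => ?_⟩
  · obtain ⟨e, a, b, ha, hb, hqb, hab⟩ := key q hq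
    refine ⟨e, lineRestrict K r a, lineRestrict K r b, lineRestrict_mem_homPart ha,
      lineRestrict_mem_homPart hb, hqb, ?_⟩
    simpa using congrArg GenericStalk.fst hab
  · obtain ⟨e, a, b, ha, hb, hqb, hab⟩ := key q hq
    obtain ⟨a', ha', haa⟩ := (GenericStalk.algebraMap_mem_part h.homogeneous_left ha).2 i
    obtain ⟨b', hb', hbb⟩ := (GenericStalk.algebraMap_mem_part h.homogeneous_left hb).2 i
    have h1 := congrArg GenericStalk.fst hab
    have h2 := congrArg (fun υ => GenericStalk.snd υ i) hab
    simp only [GenericStalk.fst_mul, GenericStalk.snd_mul, GenericStalk.fst_algebraMap] at h1 h2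
    -- Writing `b₀, a₀` for the restrictions, the equation `b τ = a` reads `b₀ τ₀ = a₀` and `b₀ τ_i
    -- + τ₀ b' = a'`. Eliminating `τ₀` gives `b₀² τ_i = b₀ a' - a₀ b'`.
    refine ⟨e + e, lineRestrict K r b * a' - lineRestrict K r a * b',
      lineRestrict K r b * lineRestrict K r b, ?_, ?_, ?_, ?_⟩
    · refine Submodule.sub_mem _ ?_ ?_
      · have := mul_mem_homPart_add (lineRestrict_mem_homPart hb) ha'
        convert this using 2
        ring
      · have := mul_mem_homPart_add (lineRestrict_mem_homPart ha) hb'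
        convert this using 2
        ring
    · exact mul_mem_homPart_add (lineRestrict_mem_homPart hb) (lineRestrict_mem_homPart hb)
    · intro hq2
      rcases hq.prime.dvd_or_dvd hq2 with h3 | h3 <;> exact hqb h3
    · have haa' : algebraMap (LineRing K) (LineField K) a' = _ := haa
      have hbb' : algebraMap (LineRing K) (LineField K) b' = _ := hbb
      rw [map_sub, map_mul, map_mul, map_mul, haa', hbb', ← h2, ← h1]
      ring

/-- Evaluation of sections of degree `d` at the generic point. -/
def sectionEval (d : ℤ) : twistSections I d →+ GenericStalk A where
  toFun s := h.stalkEval h.generic (s.1 h.generic)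
  map_zero' := map_zero _
  map_add' s s' := map_add (h.stalkEval h.generic) (s.1 h.generic) (s'.1 h.generic)

lemma lift_sectionEval_smul (f : SpaceRing K r) (s : GlobalSections I) :
    GlobalSections.lift h.sectionEval (f • s) = f • GlobalSections.lift h.sectionEval s := by
  obtain ⟨t, g, rfl⟩ := s.exists_sum_of
  rw [Finset.smul_sum, map_sum, map_sum, Finset.smul_sum]
  refine Finset.sum_congr rfl fun d _ => ?_
  rw [← sum_homComponent f, Finset.sum_smul, map_sum, Finset.sum_smul]
  refine Finset.sum_congr rfl fun e _ => ?_
  obtain ⟨hs, he⟩ := GlobalSections.smul_of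
    (homPart_natCast _ K e ▸ homComponent_mem (e : ℤ) f) d (g d)
  rw [he, GlobalSections.lift_of, GlobalSections.lift_of]
  exact map_smul (h.stalkEval h.generic) _ ((g d).1 h.generic)

/-- Evaluation of global sections at the generic point. -/
def globalEval : GlobalSections I →ₗ[SpaceRing K r] GenericStalk A where
  toFun := GlobalSections.lift h.sectionEval
  map_add' := map_add _
  map_smul' := h.lift_sectionEval_smul

lemma globalEval_of {d : ℤ} (s : twistSections I d) :
    h.globalEval (GlobalSections.of I d s) = h.stalkEval h.generic (s.1 h.generic) :=
  GlobalSections.lift_of _ _ _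

/-- The values of the homogeneous components of a section have different degrees, so they cannot
cancel; each component is then determined by its value. -/
lemma globalEval_injective : Function.Injective h.globalEval := by
  rw [injective_iff_map_eq_zero]
  intro s hs
  obtain ⟨t, g, rfl⟩ := s.exists_sum_of
  refine Finset.sum_eq_zero fun d hd => ?_
  have hpart : ∀ d, h.globalEval (GlobalSections.of I d (g d)) ∈ GenericStalk.part A α d := by
    intro d
    rw [globalEval_of]
    exact h.stalkEval_mem_part (g d).2
  rw [map_sum] at hs
  have h0 : h.globalEval (GlobalSections.of I d (g d)) = 0 := by
    ext i
    · refine eq_zero_of_sum_fracPart_eq_zero (c := 0) (t := t)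
        (f := fun d => (h.globalEval (GlobalSections.of I d (g d))).fst)
        (fun d _ => by rw [add_zero]; exact (hpart d).1) ?_ d hd
      rw [← GenericStalk.fst_sum, hs, GenericStalk.fst_zero]
    · refine eq_zero_of_sum_fracPart_eq_zero (c := α i - 1) (t := t)
        (f := fun d => (h.globalEval (GlobalSections.of I d (g d))).snd i)
        (fun d _ => (hpart d).2 i) ?_ d hd
      rw [← GenericStalk.snd_sum, hs, GenericStalk.snd_zero]
  rw [globalEval_of] at h0
  have h1 : g d = 0 := Subtype.ext (h.eq_zero_of_stalkEval_eq_zero (g d).2 h0)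
  rw [h1, map_zero]

lemma globalEval_one : h.globalEval (GlobalSections.one I) = 1 := by
  refine (h.globalEval_of _).trans ?_
  have := h.algebraMap_mul_stalkEval_mk (p := h.generic) 1 1
  simpa using this

/-- The sections `z_i`. -/
lemma exists_section (i : Fin m) : ∃ s ∈ GlobalSections.part I (1 - α i),
    h.globalEval s = GenericStalk.z A i := by
  choose e c w hcp hc hw hAw using h.exists_fraction i
  have hval : ∀ p, algebraMap (SpaceRing K r) (GenericStalk A)
      (∑ l, X (Sum.inl l) * incl K r (w p l)) =
      algebraMap _ _ (incl K r (c p)) * GenericStalk.z A i := by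
    intro p
    ext i'
    · simp
    · have h1 := congrArg (algebraMap (LineRing K) (LineField K)) (hAw p i')
      simp only [map_sum, map_mul] at h1
      simp only [map_sum, map_mul, GenericStalk.snd_sum, GenericStalk.snd_mul,
        GenericStalk.fst_algebraMap_X_inl, GenericStalk.snd_algebraMap_X_inl,
        GenericStalk.fst_algebraMap_incl, GenericStalk.snd_algebraMap_incl, GenericStalk.fst_z,
        GenericStalk.snd_z, zero_add, add_zero, mul_ite, mul_one, mul_zero]
      rw [← map_zero (algebraMap (LineRing K) (LineField K)), ← apply_ite, ← h1]
      exact Finset.sum_congr rfl fun l _ => mul_comm _ _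
  -- A fraction is chosen independently at each point. Since all of them represent `z_i` in the
  -- generic stalk, the one chosen at `p` represents `s` wherever its denominator does not vanish.
  let s : ∀ p : Points I, Stalk I p := fun p => LocalizedModule.mk
    (Ideal.Quotient.mk I (∑ l, X (Sum.inl l) * incl K r (w p l))) ⟨incl K r (c p), hcp p⟩
  have hs : s ∈ twistSections I (1 - α i) := by
    intro p
    refine ⟨Subtype.val ⁻¹' (ProjectiveSpectrum.basicOpen (homogeneousSubmodule (Fin (r + 1) ⊕ Fin 2) K) (incl K r (c p)) :
        Set (ProjectiveSpectrum (homogeneousSubmodule (Fin (r + 1) ⊕ Fin 2) K))),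
      (ProjectiveSpectrum.isOpen_basicOpen _).preimage continuous_subtype_val, hcp p, e p,
      ∑ l, X (Sum.inl l) * incl K r (w p l), incl K r (c p), ?_,
      IsHomogeneous.rename_isHomogeneous (hc p), fun q hq => ⟨hq, ?_⟩⟩
    · refine Submodule.sum_mem _ fun l _ => ?_
      have := mul_mem_homPart_add (X_mem_homPart (K := K) (Sum.inl l : Fin (r + 1) ⊕ Fin 2))
        (incl_mem_homPart (r := r) (hw p l))
      convert this using 2
      ring
    · apply h.mk_eq_mk
      rw [map_mul, map_mul, hval, hval]
      ring
  refine ⟨GlobalSections.of I _ ⟨s, hs⟩, ⟨_, rfl⟩, ?_⟩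
  rw [globalEval_of]
  have h1 := h.algebraMap_mul_stalkEval_mk (p := h.generic)
    (∑ l, X (Sum.inl l) * incl K r (w h.generic l)) ⟨incl K r (c h.generic), hcp _⟩
  rw [hval] at h1
  exact (h.isUnit_algebraMap (hcp h.generic)).mul_left_cancel h1

end IsRelated

end Evaluation

/-! ### The augmentation -/

section Augmentation

variable {K : Type*} [Field K] {r m k : ℕ} {I : Ideal (SpaceRing K r)}

/-- The isomorphism `⋀⁰ P = R`. -/
abbrev coeffZero (K : Type*) [Field K] (r : ℕ) : KoszulTerm K r 0 ≃ₗ[SpaceRing K r] SpaceRing K r :=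
  exteriorPower.zeroEquiv (SpaceRing K r) (Fin (r + 1) → SpaceRing K r)

lemma augmentation_apply (z : Fin m → GlobalSections I) (x : Term K r m 0) :
    augmentation I z x = coeffZero K r (x none) • GlobalSections.one I +
      ∑ i, coeffZero K r (x (some i)) • z i := by
  simp [augmentation]

lemma GlobalSections.smul_mem_part {d e : ℤ} {f : SpaceRing K r} (hf : f ∈ homPart _ K e)
    {s : GlobalSections I} (hs : s ∈ GlobalSections.part I d) :
    f • s ∈ GlobalSections.part I (e + d) := by
  by_cases he : 0 ≤ e
  · lift e to ℕ using he
    rw [homPart_natCast] at hf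
    obtain ⟨s, rfl⟩ := hs
    obtain ⟨hs, h⟩ := GlobalSections.smul_of hf d s
    exact h ▸ ⟨_, rfl⟩
  · rw [eq_zero_of_mem_homPart_of_neg (by omega) hf, zero_smul]
    exact AddSubgroup.zero_mem _

lemma augmentation_mem_part {α : Fin m → ℤ} {z : Fin m → GlobalSections I}
    (hz : ∀ i, z i ∈ GlobalSections.part I (1 - α i)) (d : ℤ) (x : Term K r m 0)
    (hx : x ∈ termPart K r α 0 d) : augmentation I z x ∈ GlobalSections.part I d := by
  have hx' : ∀ i, x i ∈ koszulPart K r 0 (extDegree α i - 1) d := by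
    simpa [termPart, AddSubgroup.mem_pi] using hx
  rw [augmentation_apply]
  refine AddSubgroup.add_mem _ ?_ (AddSubgroup.sum_mem _ fun i _ => ?_)
  · have h1 : GlobalSections.one I ∈ GlobalSections.part I 0 := ⟨_, rfl⟩
    have h2 := GlobalSections.smul_mem_part (zeroEquiv_mem_homPart (hx' none)) h1
    simpa [extDegree] using h2
  · have h2 := GlobalSections.smul_mem_part (zeroEquiv_mem_homPart (hx' (some i))) (hz i)
    rwa [extDegree, show d + (α i - 1) + (1 - α i) = d by ring] at h2

variable {α : Fin m → ℤ} {β : Fin k → ℤ} {A : Matrix (Fin m) (Fin (r + 1)) (LineRing K)}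
  {B : Matrix (Fin (r + 1)) (Fin k) (LineRing K)}

namespace IsRelated

variable (h : IsRelated I α β A B)
include h

/-- A zero row would contradict the surjectivity of `A` at the generic point. -/
lemma exists_ne_zero (i : Fin m) : ∃ l, A i l ≠ 0 := by
  by_contra! hA
  obtain ⟨e, c, w, hc, -, -, hAw⟩ := h.exists_fraction i h.generic
  have h1 := hAw i
  simp only [hA, zero_mul, Finset.sum_const_zero, if_pos] at h1
  rw [← h1, map_zero] at hc
  exact hc (Submodule.zero_mem _)

variable {z : Fin m → GlobalSections I} (hz : ∀ i, h.globalEval (z i) = GenericStalk.z A i)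
include hz

lemma X_smul_one (j : Fin (r + 1)) :
    (X (Sum.inl j) : SpaceRing K r) • GlobalSections.one I = ∑ i, incl K r (A i j) • z i := by
  apply h.globalEval_injective
  simp only [map_sum, map_smul, h.globalEval_one, hz, Algebra.smul_def]
  ext i
  · simp
  · simp

lemma fst_globalEval_augmentation (x : Term K r m 0) :
    (h.globalEval (augmentation I z x)).fst =
      algebraMap _ _ (lineRestrict K r (coeffZero K r (x none))) := by
  simp [augmentation_apply, h.globalEval_one, hz, Algebra.smul_def]

lemma snd_globalEval_augmentation (x : Term K r m 0) (i : Fin m) :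
    (h.globalEval (augmentation I z x)).snd i =
      (algebraMap (SpaceRing K r) (GenericStalk A) (coeffZero K r (x none))).snd i +
      algebraMap _ _ (lineRestrict K r (coeffZero K r (x (some i)))) := by
  simp [augmentation_apply, h.globalEval_one, hz, Algebra.smul_def]

/-- By injectivity of `globalEval` it suffices to match values, and the coefficients of the value of
`s` in `S` supply the preimage. -/
lemma augmentation_surjective : Function.Surjective (augmentation I z) := by
  intro s
  have hs : ∃ s' : LineRing K, algebraMap _ _ s' = (h.globalEval s).fst ∧
      ∃ v : Fin m → LineRing K, ∀ i, algebraMap _ _ (v i) = (h.globalEval s).snd i := by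
    obtain ⟨t, g, rfl⟩ := s.exists_sum_of
    have hpart : ∀ d, h.globalEval (GlobalSections.of I d (g d)) ∈ GenericStalk.part A α d := by
      intro d
      rw [globalEval_of]
      exact h.stalkEval_mem_part (g d).2
    choose a ha hfa using fun d => (hpart d).1
    choose b hb hfb using fun d => (hpart d).2
    refine ⟨∑ d ∈ t, a d, ?_, fun i => ∑ d ∈ t, b d i, fun i => ?_⟩
    · rw [map_sum, map_sum, GenericStalk.fst_sum]
      exact Finset.sum_congr rfl fun d _ => hfa d
    · rw [map_sum, map_sum, GenericStalk.snd_sum]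
      exact Finset.sum_congr rfl fun d _ => hfb d i
  obtain ⟨s', hs', v, hv⟩ := hs
  refine ⟨fun o => (coeffZero K r).symm (incl K r (o.elim s' v)), h.globalEval_injective ?_⟩
  ext i
  · rw [h.fst_globalEval_augmentation hz, ← hs']
    simp
  · rw [h.snd_globalEval_augmentation hz, ← hv]
    simp

lemma augmentation_exact : Function.Exact (epsilon A 0) (augmentation I z) := by
  have hinjF := IsFractionRing.injective (LineRing K) (LineField K)
  set O := exteriorPower.oneEquiv (SpaceRing K r) (Fin (r + 1) → SpaceRing K r) with hO
  have hδ : ∀ (v y : Fin (r + 1) → SpaceRing K r),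
      coeffZero K r (koszulMap v 0 (O.symm y)) = ∑ l, v l * y l := zeroEquiv_koszulMap
  intro x
  rw [← map_eq_zero_iff _ h.globalEval_injective]
  constructor
  · intro hx
    have hfst := congrArg GenericStalk.fst hx
    rw [h.fst_globalEval_augmentation hz, GenericStalk.fst_zero, map_eq_zero_iff _ hinjF,
      lineRestrict_eq_zero_iff, mem_lineIdeal_iff] at hfst
    obtain ⟨y, hy⟩ := hfst
    -- The coefficient of `1` vanishes, so the component `-1` is `∑ x_l y_l`, which contributes `∑
    -- A_{il} y_l` to the coefficient of `z_i`. As that coefficient vanishes too, the left side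
    -- restricts to zero on the line and so lies in `I_L`.
    have hi : ∀ i, ∃ b : Fin (r + 1) → SpaceRing K r, coeffZero K r (x (some i)) + ∑ l, incl K r (A i l) * y l =
        ∑ l, X (Sum.inl l) * b l := by
      intro i
      rw [← mem_lineIdeal_iff, ← lineRestrict_eq_zero_iff]
      apply hinjF
      have hsnd := congrArg (fun τ => GenericStalk.snd τ i) hx
      simp only [h.snd_globalEval_augmentation hz, GenericStalk.snd_zero] at hsnd
      rw [map_zero]
      refine Eq.trans ?_ hsnd
      rw [hy]
      simp only [map_add, map_sum, map_mul, lineRestrict_incl, GenericStalk.snd_sum,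
        GenericStalk.snd_mul, lineRestrict_X_inl, GenericStalk.snd_algebraMap_X_inl,
        GenericStalk.fst_algebraMap, map_zero, zero_mul, zero_add]
      rw [add_comm]
      exact congrArg₂ _ (Finset.sum_congr rfl fun l _ => mul_comm _ _) rfl
    choose b hb using hi
    refine ⟨fun o => O.symm (o.elim y b), ?_⟩
    ext o : 1
    apply (coeffZero K r).injective
    rcases o with _ | i
    · rw [epsilon_apply_none, hδ, hy]
      rfl
    · rw [epsilon_apply_some, map_add, map_neg, hδ, hδ]
      simp only [Option.elim]
      rw [← hb i]
      ring
  · rintro ⟨y, rfl⟩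
    obtain ⟨y, rfl⟩ : ∃ y', y = fun o => O.symm (y' o) :=
      ⟨fun o => O (y o), by simp⟩
    ext i
    · rw [h.fst_globalEval_augmentation hz, epsilon_apply_none, hδ]
      simp
    · rw [h.snd_globalEval_augmentation hz, epsilon_apply_none, epsilon_apply_some, map_add,
        map_neg, hδ, hδ, hδ]
      simp [mul_comm]

end IsRelated

end Augmentation

end Rope

end

theorem mainTheorem7 {K : Type*} [Field K] (r k : ℕ) (hk : k ≤ r + 1)
    (I : Ideal (Rope.SpaceRing K r)) (hI : Rope.IsRope I (r + 2 - k))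
    (α : Fin (r + 1 - k) → ℤ) (β : Fin k → ℤ)
    (A : Matrix (Fin (r + 1 - k)) (Fin (r + 1)) (Rope.LineRing K))
    (B : Matrix (Fin (r + 1)) (Fin k) (Rope.LineRing K))
    (hAB : Rope.IsRelated I α β A B) :
    ∃ z : Fin (r + 1 - k) → Rope.GlobalSections I,
      (∀ i, z i ∈ Rope.GlobalSections.part I (1 - α i)) ∧
      (∀ j : Fin (r + 1), (X (Sum.inl j) : Rope.SpaceRing K r) • Rope.GlobalSections.one I =
        ∑ i, Rope.incl K r (A i j) • z i) ∧
      Rope.IsGradedFreeResolution (Rope.termPart K r α) (Rope.epsilon A)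
        (Rope.GlobalSections.part I) (Rope.augmentation I z) ∧
      Function.Injective (Rope.epsilon A r) ∧
      (Rope.IsMinimal (Rope.epsilon A) ↔ ∀ i, 1 ≤ α i) := by
  choose z hzd hz using hAB.exists_section
  exact ⟨z, hzd, hAB.X_smul_one hz,
    { free := fun j => Rope.isGradedFree_termPart j α
      degree_zero := fun j => Rope.epsilon_mem_termPart j hAB.homogeneous_left
      augmentation_degree_zero := Rope.augmentation_mem_part hzd
      exact := Rope.epsilon_exact A
      augmentation_exact := hAB.augmentation_exact hz
      augmentation_surjective := hAB.augmentation_surjective hz },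
    Rope.epsilon_injective A,
    Rope.isMinimal_epsilon_iff hAB.homogeneous_left hAB.exists_ne_zero⟩
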